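/- **Setting.** Fix a (possibly many-sorted) signature; structures may be empty. Positive formulas are built from atomic formulas (including equality) with $\top,\bot,\wedge,\vee,\exists$; below, "formula" means positive formula. A (positive) theory is a set $T$ of h-inductive sentences $\forall x(\phi(x)\to\psi(x))$ with $\phi,\psi$ positive. A formula $\psi(x)$ is an *obstruction* of $\phi(x)$ if $T\models\neg\exists x(\phi(x)\wedge\psi(x))$. A model $M$ of $T$ is *positively closed* (p.c.) if whenever $M\not\models\phi(a)$, there is an obstruction $\psi$ of $\phi$ with $M\models\psi(a)$. Write $|T|$ for the number of formulas $\phi(x)$ in finite tuples of variables, up to equivalence modulo $T$. Assume that $T$ has the joint continuation property (any two models of $T$ admit homomorphisms into a common model of $T$) and let $\mathfrak M$ be a monster model of $T$, where "small" means of cardinality below a fixed inaccessible cardinal larger than the number of symbols of the signature: $\mathfrak M$ is a p.c. model of $T$, any two small tuples with the same type are conjugate under an automorphism of $\mathfrak M$, and every finitely satisfiable small set of formulas with parameters in $\mathfrak M$, in a small tuple of variables, is satisfiable in $\mathfrak M$. All sets and tuples below are small and in $\mathfrak M$, all cardinals ($\kappa$, $\lambda$) and ordinals ($\mu$, $i_0$)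 are small, consistency means satisfiability in $\mathfrak M$, and $a\equiv_C a'$ means that $a$ and $a'$ satisfy the same formulas over $C$. A sequence $(b_i)_{i<\omega}$ is *$C$-indiscernible* if $b_{i_1}\dots b_{i_n}\equiv_C b_{j_1}\dots b_{j_n}$ for all $i_1<\dots<i_n$ and $j_1<\dots<j_n$. A set $\Sigma(x,b)$ of formulas over $Cb$ *divides over $C$* if there is a $C$-indiscernible sequence $(b_i)_{i<\omega}$ with $b_i\equiv_C b$ for all $i$ such that $\bigcup_{i<\omega}\Sigma(x,b_i)$ is inconsistent. *Dividing independence* $A\perp^d_C B$ holds if, for enumerations $a$ of $A$ and $b$ of $B$, the set $\mathrm{tp}(a/Cb)$ of all formulas over $Cb$ satisfied by $a$ does not divide over $C$; tuples (and families of tuples) are identified with the sets they enumerate. For $k\ge 2$, a formula $\phi(x,y)$ (with $x,y$ finite tuples of variables) has the *$k$-tree property* if there are parameters $(c_\eta)_{\eta\in\omega^{<\omega}}$ and an obstruction $\psi(y_1,\dots,y_k)$ of $\exists x(\phi(x,y_1)\wedge\dots\wedge\phi(x,y_k))$ such that $\{\phi(x,c_{\sigma|_n}):n<\omega\}$ is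 consistent for every $\sigma\in\omega^\omega$, and $\models\psi(c_{\eta^\frown i_1},\dots,c_{\eta^\frown i_k})$ for all $\eta\in\omega^{<\omega}$ and $i_1<\dots<i_k<\omega$. $T$ is *NTP* if no formula has the $k$-tree property for any $k\ge2$. **Theorem.** The following are equivalent. 1. Dividing independence has local character: for every cardinal $\kappa$ there is a cardinal $\lambda$ such that for all $a$ with $|a|<\kappa$ and every $C$ there is $C'\subseteq C$ with $|C'|<\lambda$ and $a\perp^d_{C'}C$. 2. For every finite $a$ and every $C$ there is $C'\subseteq C$ with $|C'|<|T|^+$ and $a\perp^d_{C'}C$. 3. For every cardinal $\kappa$ there is a cardinal $\lambda$ such that for all $a$ with $|a|<\kappa$ and every sequence $(b_i)_{i<\mu}$ of length $\mu\le\lambda$ there is $i_0<\lambda$ with $a\perp^d_{(b_j)_{j<\min(i_0,\mu)}}(b_j)_{i_0\le j<\mu}$. 4. For every finite $a$ and every sequence $(b_i)_{i<\mu}$ of length $\mu\le|T|^+$ there is $i_0<|T|^+$ with $a\perp^d_{(b_j)_{j<\min(i_0,\mu)}}(b_j)_{i_0\le j<\mu}$. 5. $T$ is NTP. -/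

import Mathlib

universe u v v' w

namespace PositiveLogic

/-! ### Many-sorted signatures, positive formulas, structures

Everything indexed by sorts is written as a family over the type of sorts: a tuple of variables is
a family `V : L.Srt → Type*` (`V s` being the variables of sort `s`), a tuple of elements of a
structure is a family of functions `∀ s, V s → M.Carrier s`, and a set of elements is a family of
sets `∀ s, Set (M.Carrier s)`. -/

/-- A (possibly many-sorted) signature; a constant symbol of sort `s` is an element of
`Func [] s`. -/
structure Signature where
  /-- the sorts -/
  Srt : Type u
  /-- function symbols with given argument sorts and value sort -/
  Func : List Srt → Srt → Type u
  /-- relation symbols with given argument sorts -/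
  Rel : List Srt → Type u

/-- The finite tuple of variables (or positions) `x₁ … xₙ` of sorts listed in `Γ`; `Var Γ s`
consists of those that have sort `s`. -/
inductive Var {S : Type u} : List S → S → Type u
  | zero {Γ : List S} {s : S} : Var (s :: Γ) s
  | succ {Γ : List S} {s t : S} : Var Γ s → Var (t :: Γ) s

/-- Terms in variables `V`. -/
inductive Term (L : Signature.{u}) (V : L.Srt → Type v) : L.Srt → Type (max u v)
  | var {s : L.Srt} : V s → Term L V s
  | app {l : List L.Srt} {s : L.Srt} (f : L.Func l s) (ts : ∀ t, Var l t → Term L V t) :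
      Term L V s

/-- Positive formulas with free variables `V` and, additionally, the variables of the list `Γ`
that are still to be bound by quantifiers. The quantifier `ex s` binds the first entry of the
list. -/
inductive PForm (L : Signature.{u}) (V : L.Srt → Type v) : List L.Srt → Type (max u v)
  | top {Γ : List L.Srt} : PForm L V Γ
  | bot {Γ : List L.Srt} : PForm L V Γ
  | eq {Γ : List L.Srt} {s : L.Srt} (t₁ t₂ : Term L (fun r => V r ⊕ Var Γ r) s) : PForm L V Γ
  | rel {Γ l : List L.Srt} (R : L.Rel l)
      (ts : ∀ t, Var l t → Term L (fun r => V r ⊕ Var Γ r) t) : PForm L V Γ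
  | and {Γ : List L.Srt} (φ ψ : PForm L V Γ) : PForm L V Γ
  | or {Γ : List L.Srt} (φ ψ : PForm L V Γ) : PForm L V Γ
  | ex {Γ : List L.Srt} (s : L.Srt) (φ : PForm L V (s :: Γ)) : PForm L V Γ

/-- Positive formulas with free variables among `V`. -/
abbrev Formula (L : Signature.{u}) (V : L.Srt → Type v) : Type (max u v) := PForm L V []

/-- Structures; empty sorts are allowed. -/
structure Structure (L : Signature.{u}) where
  /-- the underlying sets -/
  Carrier : L.Srt → Type w
  /-- interpretation of function symbols -/
  func : ∀ {l : List L.Srt} {s : L.Srt}, L.Func l s → (∀ t, Var l t → Carrier t) → Carrier s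
  /-- interpretation of relation symbols -/
  rel : ∀ {l : List L.Srt}, L.Rel l → (∀ t, Var l t → Carrier t) → Prop

variable {L : Signature.{u}}

/-- The value of a term. -/
def Term.eval (M : Structure.{u, w} L) {V : L.Srt → Type v} (a : ∀ s, V s → M.Carrier s) :
    ∀ {s : L.Srt}, Term L V s → M.Carrier s
  | _, .var x => a _ x
  | _, .app f ts => M.func f fun t i => (ts t i).eval M a

/-- The concatenation of two tuples. -/
def join {S : Type u} {X : S → Type w} {V : S → Type v} {W : S → Type v'}
    (a : ∀ s, V s → X s) (b : ∀ s, W s → X s) : ∀ s, V s ⊕ W s → X s :=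
  fun s => Sum.elim (a s) (b s)

/-- The tuple `m, e₁, …, eₙ`. -/
def push {S : Type u} {X : S → Type w} {s : S} {Γ : List S} (m : X s) (e : ∀ t, Var Γ t → X t) :
    ∀ t, Var (s :: Γ) t → X t
  | _, .zero => m
  | _, .succ i => e _ i

/-- The empty tuple. -/
def nil {S : Type u} {X : S → Type w} : ∀ t, Var ([] : List S) t → X t := fun _ i => nomatch i

/-- Satisfaction of formulas, the free variables being interpreted by `a`, the pending ones
by `e`. -/
def PForm.Sat (M : Structure.{u, w} L) {V : L.Srt → Type v} (a : ∀ s, V s → M.Carrier s) :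
    ∀ {Γ : List L.Srt}, PForm L V Γ → (∀ t, Var Γ t → M.Carrier t) → Prop
  | _, .top, _ => True
  | _, .bot, _ => False
  | _, .eq t₁ t₂, e => t₁.eval M (join a e) = t₂.eval M (join a e)
  | _, .rel R ts, e => M.rel R fun t i => (ts t i).eval M (join a e)
  | _, .and φ ψ, e => φ.Sat M a e ∧ ψ.Sat M a e
  | _, .or φ ψ, e => φ.Sat M a e ∨ ψ.Sat M a e
  | _, .ex s φ, e => ∃ m : M.Carrier s, φ.Sat M a (push m e)

/-- `M ⊨ φ(a)`. -/
def Formula.Realize {V : L.Srt → Type v} (φ : Formula L V) (M : Structure.{u, w} L)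
    (a : ∀ s, V s → M.Carrier s) : Prop := PForm.Sat M a φ nil

/-! ### Positive theories and positively closed models -/

/-- An h-inductive sentence `∀ x (hyp(x) → concl(x))`, where `x` is a finite tuple of variables
of the sorts in `ctx`. -/
structure HInductive (L : Signature.{u}) where
  /-- the sorts of the quantified variables -/
  ctx : List L.Srt
  /-- the premise -/
  hyp : Formula L (Var ctx)
  /-- the conclusion -/
  concl : Formula L (Var ctx)

/-- Truth of an h-inductive sentence. -/
def HInductive.Holds (χ : HInductive L) (M : Structure.{u, w} L) : Prop :=
  ∀ a : ∀ s, Var χ.ctx s → M.Carrier s, χ.hyp.Realize M a → χ.concl.Realize M a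

/-- A positive theory. -/
abbrev Theory (L : Signature.{u}) : Type u := Set (HInductive L)

/-- `M ⊨ T`. -/
def IsModel (T : Theory L) (M : Structure.{u, w} L) : Prop := ∀ χ ∈ T, χ.Holds M

/-- `ψ(x)` is an obstruction of `φ(x)`: `T ⊨ ¬∃ x (φ(x) ∧ ψ(x))`. -/
def IsObstruction (T : Theory L) {V : L.Srt → Type v} (φ ψ : Formula L V) : Prop :=
  ∀ M : Structure.{u, u + 1} L, IsModel T M →
    ¬ ∃ a : ∀ s, V s → M.Carrier s, φ.Realize M a ∧ ψ.Realize M a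

/-- `M` is a positively closed model of `T`: it is a model, and every formula that fails at a
finite tuple has an obstruction that holds at that tuple. -/
def IsPC (T : Theory L) (M : Structure.{u, w} L) : Prop :=
  IsModel T M ∧ ∀ (Γ : List L.Srt) (φ : Formula L (Var Γ)) (a : ∀ s, Var Γ s → M.Carrier s),
    ¬ φ.Realize M a → ∃ ψ : Formula L (Var Γ), IsObstruction T φ ψ ∧ ψ.Realize M a

/-- Homomorphisms of structures. -/
structure Hom (M : Structure.{u, w} L) (N : Structure.{u, w} L) where
  /-- the underlying maps -/
  map : ∀ s, M.Carrier s → N.Carrier s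
  map_func : ∀ {l : List L.Srt} {s : L.Srt} (f : L.Func l s) (a : ∀ t, Var l t → M.Carrier t),
    map s (M.func f a) = N.func f fun t i => map t (a t i)
  map_rel : ∀ {l : List L.Srt} (R : L.Rel l) (a : ∀ t, Var l t → M.Carrier t),
    M.rel R a → N.rel R fun t i => map t (a t i)

/-- Automorphisms of a structure: bijective homomorphisms that also reflect the relations. -/
structure Auto (M : Structure.{u, w} L) extends Hom M M where
  bijective : ∀ s, Function.Bijective (map s)
  reflects : ∀ {l : List L.Srt} (R : L.Rel l) (a : ∀ t, Var l t → M.Carrier t),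
    M.rel R (fun t i => map t (a t i)) → M.rel R a

/-- The joint continuation property. -/
def JCP (T : Theory L) : Prop :=
  ∀ M₁ M₂ : Structure.{u, u + 1} L, IsModel T M₁ → IsModel T M₂ →
    ∃ N : Structure.{u, u + 1} L, IsModel T N ∧ Nonempty (Hom M₁ N) ∧ Nonempty (Hom M₂ N)

/-- Equivalence of formulas in the variables of sorts `Γ` modulo `T`. -/
def equivMod (T : Theory L) (Γ : List L.Srt) : Setoid (Formula L (Var Γ)) where
  r φ ψ := ∀ M : Structure.{u, u + 1} L, IsModel T M →
    ∀ a : ∀ s, Var Γ s → M.Carrier s, φ.Realize M a ↔ ψ.Realize M a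
  iseqv := ⟨fun _ _ _ _ => Iff.rfl, fun h M hM a => (h M hM a).symm,
    fun h h' M hM a => (h M hM a).trans (h' M hM a)⟩

/-- `|T|`: the number of formulas `φ(x)`, with `x` a finite tuple of variables, up to equivalence
modulo `T`. -/
noncomputable def Theory.card (T : Theory L) : Cardinal.{u} :=
  Cardinal.mk (Σ Γ : List L.Srt, Quotient (equivMod T Γ))

/-! ### The monster model

"Small" means: of the size of a type in the universe `u` in which the signature lives. The monster
model lives one universe higher. The cardinals of the universe `u` form an initial segment of the
cardinals whose supremum is inaccessible in the next universe, so this is smallness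
with respect to an inaccessible cardinal. Small tuples are those indexed by families
`I : L.Srt → Type u`. -/

/-- Sets of elements of a structure. -/
abbrev Elems (M : Structure.{u, w} L) : Type (max u w) := ∀ s, Set (M.Carrier s)

/-- The cardinality of a set of elements. -/
noncomputable def Elems.card {M : Structure.{u, u + 1} L} (A : Elems M) : Cardinal.{u + 1} :=
  Cardinal.mk (Σ s, A s)

/-- Small sets of elements. -/
def Elems.IsSmall {M : Structure.{u, u + 1} L} (A : Elems M) : Prop := Small.{u} (Σ s, A s)

/-- The set `A` viewed as a tuple: the canonical enumeration of `A`, indexed by `A` itself. -/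
def Elems.tuple {M : Structure.{u, w} L} (A : Elems M) : ∀ s, A s → M.Carrier s :=
  fun _ x => x.1

/-- `a ≡_C a'`: the tuples `a` and `a'` satisfy the same formulas over `C`. -/
def SameType (M : Structure.{u, w} L) (C : Elems M) {I : L.Srt → Type v}
    (a a' : ∀ s, I s → M.Carrier s) : Prop :=
  ∀ φ : Formula L (fun s => I s ⊕ C s),
    φ.Realize M (join a C.tuple) ↔ φ.Realize M (join a' C.tuple)

/-- `M` is a monster model of `T`. -/
structure IsMonster (T : Theory L) (M : Structure.{u, u + 1} L) : Prop where
  pc : IsPC T M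
  /-- very homogeneous: small tuples of the same type are conjugate under an automorphism -/
  homogeneous : ∀ (I : L.Srt → Type u) (a b : ∀ s, I s → M.Carrier s),
    SameType M (fun _ => ∅) a b → ∃ f : Auto M, ∀ s i, f.map s (a s i) = b s i
  /-- very saturated: a finitely satisfiable set of formulas `Φ(x, p)`, where `x` is a small tuple
  of variables and `p` is a small tuple of parameters, is satisfiable -/
  saturated : ∀ (X P : L.Srt → Type u) (p : ∀ s, P s → M.Carrier s)
    (Φ : Set (Formula L (fun s => X s ⊕ P s))),
    (∀ Φ₀ ⊆ Φ, Φ₀.Finite → ∃ a : ∀ s, X s → M.Carrier s, ∀ φ ∈ Φ₀, φ.Realize M (join a p)) →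
    ∃ a : ∀ s, X s → M.Carrier s, ∀ φ ∈ Φ, φ.Realize M (join a p)

/-! ### Dividing -/

/-- The concatenation `b_{i₁} … b_{iₙ}`. -/
def concat {S : Type u} {X : S → Type w} {I : S → Type v} (b : ℕ → ∀ s, I s → X s) {n : ℕ}
    (i : Fin n → ℕ) : ∀ s, Fin n × I s → X s :=
  fun s x => b (i x.1) s x.2

/-- `(b_i)_{i < ω}` is a `C`-indiscernible sequence. -/
def Indiscernible (M : Structure.{u, w} L) (C : Elems M) {I : L.Srt → Type v}
    (b : ℕ → ∀ s, I s → M.Carrier s) : Prop :=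
  ∀ (n : ℕ) (i j : Fin n → ℕ), StrictMono i → StrictMono j →
    SameType M C (concat b i) (concat b j)

/-- `tp(a/Cb)`, as a set of formulas `φ(x, y, c)`, where `x` matches `a`, `y` matches `b`
and the `c` are constants for the elements of `C`. -/
def tp (M : Structure.{u, w} L) (C : Elems M) {X : L.Srt → Type v} {Y : L.Srt → Type v'}
    (a : ∀ s, X s → M.Carrier s) (b : ∀ s, Y s → M.Carrier s) :
    Set (Formula L (fun s => (X s ⊕ Y s) ⊕ C s)) :=
  {φ | φ.Realize M (join (join a b) C.tuple)}

/-- The set `Φ(x, b)` of formulas over `Cb` divides over `C`. -/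
def Divides (M : Structure.{u, w} L) (C : Elems M) {X : L.Srt → Type v} {Y : L.Srt → Type v'}
    (Φ : Set (Formula L (fun s => (X s ⊕ Y s) ⊕ C s))) (b : ∀ s, Y s → M.Carrier s) : Prop :=
  ∃ b' : ℕ → ∀ s, Y s → M.Carrier s,
    Indiscernible M C b' ∧ (∀ i, SameType M C (b' i) b) ∧
      ¬ ∃ a : ∀ s, X s → M.Carrier s, ∀ i, ∀ φ ∈ Φ, φ.Realize M (join (join a (b' i)) C.tuple)

/-- Dividing independence `A ⫝_C B`: for enumerations `a` of `A` and `b` of `B`, the type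
`tp(a/Cb)` does not divide over `C`. -/
def DivIndep (M : Structure.{u, w} L) (A C B : Elems M) : Prop :=
  ¬ Divides M C (tp M C A.tuple B.tuple) B.tuple

/-- Local character of a ternary relation `R A C B` ("`A` is independent from `B` over `C`"). -/
def LocalCharacter {M : Structure.{u, u + 1} L} (R : Elems M → Elems M → Elems M → Prop) : Prop :=
  ∀ κ : Cardinal.{u}, ∃ lam : Cardinal.{u},
    ∀ A : Elems M, A.card < Cardinal.lift.{u + 1} κ → ∀ C : Elems M, C.IsSmall →
      ∃ C' : Elems M, C' ≤ C ∧ C'.card < Cardinal.lift.{u + 1} lam ∧ R A C' C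

/-- For a sequence `(b_j)_{j < μ}` of sets, the union of the `b_j` with `j < i` and `j < μ`. -/
def below {M : Structure.{u, w} L} (μ : Ordinal.{u}) (b : Set.Iio μ → Elems M) (i : Ordinal.{u}) :
    Elems M :=
  fun s => {m | ∃ j : Set.Iio μ, j.1 < i ∧ m ∈ b j s}

/-- For a sequence `(b_j)_{j < μ}` of sets, the union of the `b_j` with `i ≤ j < μ`. -/
def above {M : Structure.{u, w} L} (μ : Ordinal.{u}) (b : Set.Iio μ → Elems M) (i : Ordinal.{u}) :
    Elems M :=
  fun s => {m | ∃ j : Set.Iio μ, i ≤ j.1 ∧ m ∈ b j s}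

/-! ### The tree property -/

/-- The formula `φ(x, y)`, with `x` and `y` finite tuples of variables, has the `k`-tree property,
witnessed in the monster model `M`: there are an obstruction `ψ(y₁, …, y_k)` of
`∃ x (φ(x, y₁) ∧ … ∧ φ(x, y_k))` and parameters `(c_η)`, for `η` a finite sequence of natural
numbers, such that `φ` is consistent along every branch and `ψ` holds along the immediate
successors of every node. -/
def HasTreeProperty (T : Theory L) (M : Structure.{u, u + 1} L) (k : ℕ) {Γ Δ : List L.Srt}
    (φ : Formula L (fun s => Var Γ s ⊕ Var Δ s)) : Prop :=
  ∃ (ψ : Formula L (fun s => Fin k × Var Δ s)) (c : List ℕ → ∀ s, Var Δ s → M.Carrier s),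
    (∀ N : Structure.{u, u + 1} L, IsModel T N →
      ¬ ∃ y : Fin k → ∀ s, Var Δ s → N.Carrier s,
        (∃ x : ∀ s, Var Γ s → N.Carrier s, ∀ j, φ.Realize N (join x (y j))) ∧
          ψ.Realize N (fun s z => y z.1 s z.2)) ∧
    (∀ σ : ℕ → ℕ, ∃ x : ∀ s, Var Γ s → M.Carrier s,
      ∀ n : ℕ, φ.Realize M (join x (c ((List.range n).map σ)))) ∧
    (∀ (η : List ℕ) (i : Fin k → ℕ), StrictMono i →
      ψ.Realize M (fun s z => c (η ++ [i z.1]) s z.2))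

/-- `T` is NTP: no formula has the `k`-tree property, for any `k ≥ 2`. -/
def NTP (T : Theory L) (M : Structure.{u, u + 1} L) : Prop :=
  ¬ ∃ (k : ℕ) (Γ Δ : List L.Srt) (φ : Formula L (fun s => Var Γ s ⊕ Var Δ s)),
    2 ≤ k ∧ HasTreeProperty T M k φ

end PositiveLogic

/-!
Local character implies NTP, NTP implies the versions for sequences, and these imply local
character; this holds with arbitrary bounds and, for finite tuples, with the bound `|T|⁺`.

Dividing is first reduced to single formulas (`IsMonster.exists_divWitness` and
`DivWitness.not_divIndep`): `A` depends on `B` over `C` if and only if `φ(e, d)` holds for some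
finite tuples `e` in `A` and `d` in `B ∪ C`, such that `tp(d/C)` has a sequence of realizations
whose increasing `k`-tuples all satisfy one obstruction `ψ` of `∃ x (φ(x, y₁) ∧ … ∧ φ(x, y_k))`. One
direction is compactness. The other one needs indiscernible sequences. In positive logic these
cannot be obtained from Ramsey's theorem and compactness, since the negation of a formula is not
expressible. Instead, `IsMonster.exists_indiscernible` takes a maximal set `E` of formulas
`θ(x₁, …, xₙ)` that is satisfied by all increasing tuples of some infinite sequence. A very long
sequence with this property is coloured by the obstructions of a given `θ`, and the Erdős–Rado
partition property (`erdos_rado`) shows that `E` contains `θ` or an obstruction of `θ`. Hence every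
sequence that realizes `E` is indiscernible.

From NTP to sequences: if `A` depends on all final segments of a sequence of length `ν⁺`, where
`ν ≥ |T| + |A|`, then the same `φ`, `ψ` and `e` occur unboundedly often. This yields
parameters `d₀, d₁, …` such that `φ(e, dₙ)` divides over the earlier ones, and automorphisms turn
them into a tree (`IsMonster.hasTreeProperty_of_seq`).

From sequences to local character: if `A` depends on `C` over all small subsets of `C`, then finite
subsets of `C` that witness this are collected into a sequence by recursion
(`IsMonster.exists_divIndep_subset`).

From local character to NTP: by compactness a tree for the tree property may be taken as high and as
wide as desired. If it is wide, there is a path on which every node has infinitely many siblings of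
the same type over the earlier nodes (`IsMonster.exists_dividing_path`). Then `φ` divides at every
node over the earlier nodes, and local character fails for a realization of the path
(`IsMonster.exists_not_divIndep`).
-/

namespace PositiveLogic

variable {L : Signature.{u}}

/-! ### Substitution of variables, conjunctions and existential closures -/

section Formulas

variable {V : L.Srt → Type v} {W : L.Srt → Type v'}

/-- Renaming of variables in a term. -/
def Term.relabel (g : ∀ s, V s → W s) : ∀ {s : L.Srt}, Term L V s → Term L W s
  | _, .var x => .var (g _ x)
  | _, .app f ts => .app f fun t i => (ts t i).relabel g

theorem Term.eval_relabel (M : Structure.{u, w} L) (g : ∀ s, V s → W s)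
    (a : ∀ s, V s → M.Carrier s) (b : ∀ s, W s → M.Carrier s)
    (h : ∀ s x, b s (g s x) = a s x) {s : L.Srt} (t : Term L V s) :
    (t.relabel g).eval M b = t.eval M a := by
  induction t with
  | var x => exact h _ x
  | app f ts ih => simp only [Term.relabel, Term.eval, ih]

/-- The extension of a renaming to one more bound variable. -/
def liftVar {Γ Θ : List L.Srt} (ρ : ∀ s, V s ⊕ Var Γ s → W s ⊕ Var Θ s) (t : L.Srt) :
    ∀ s, V s ⊕ Var (t :: Γ) s → W s ⊕ Var (t :: Θ) s
  | _, .inl x => (ρ _ (.inl x)).map id .succ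
  | _, .inr .zero => .inr .zero
  | _, .inr (.succ i) => (ρ _ (.inr i)).map id .succ

/-- Renaming of the free and the pending variables of a formula. Free variables may become
pending and conversely. -/
def PForm.subst : ∀ {Γ Θ : List L.Srt}, (∀ s, V s ⊕ Var Γ s → W s ⊕ Var Θ s) →
    PForm L V Γ → PForm L W Θ
  | _, _, _, .top => .top
  | _, _, _, .bot => .bot
  | _, _, ρ, .eq t₁ t₂ => .eq (t₁.relabel ρ) (t₂.relabel ρ)
  | _, _, ρ, .rel R ts => .rel R fun t i => (ts t i).relabel ρ
  | _, _, ρ, .and φ ψ => .and (φ.subst ρ) (ψ.subst ρ)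
  | _, _, ρ, .or φ ψ => .or (φ.subst ρ) (ψ.subst ρ)
  | _, _, ρ, .ex s φ => .ex s (φ.subst (liftVar ρ s))

theorem PForm.sat_subst (M : Structure.{u, w} L) {Γ : List L.Srt} (φ : PForm L V Γ) :
    ∀ {Θ : List L.Srt} (ρ : ∀ s, V s ⊕ Var Γ s → W s ⊕ Var Θ s)
      (a : ∀ s, V s → M.Carrier s) (e : ∀ s, Var Γ s → M.Carrier s)
      (b : ∀ s, W s → M.Carrier s) (e' : ∀ s, Var Θ s → M.Carrier s),
      (∀ s x, join b e' s (ρ s x) = join a e s x) →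
      ((φ.subst ρ).Sat M b e' ↔ φ.Sat M a e) := by
  induction φ with
  | top => intros; rfl
  | bot => intros; rfl
  | eq t₁ t₂ =>
    intro Θ ρ a e b e' h
    simp only [PForm.subst, PForm.Sat, Term.eval_relabel M ρ _ _ h]
  | rel R ts =>
    intro Θ ρ a e b e' h
    simp only [PForm.subst, PForm.Sat, Term.eval_relabel M ρ _ _ h]
  | and φ ψ ih₁ ih₂ =>
    intro Θ ρ a e b e' h
    simp only [PForm.subst, PForm.Sat, ih₁ ρ a e b e' h, ih₂ ρ a e b e' h]
  | or φ ψ ih₁ ih₂ =>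
    intro Θ ρ a e b e' h
    simp only [PForm.subst, PForm.Sat, ih₁ ρ a e b e' h, ih₂ ρ a e b e' h]
  | ex s φ ih =>
    intro Θ ρ a e b e' h
    simp only [PForm.subst, PForm.Sat]
    refine exists_congr fun m => ih _ _ _ _ _ ?_
    have key : ∀ t (y : W t ⊕ Var Θ t),
        join b (push m e') t (y.map id (Var.succ (t := s))) = join b e' t y := by
      rintro t (y | y) <;> rfl
    rintro t (x | x)
    · simp only [liftVar, key, h]; rfl
    · cases x with
      | zero => rfl
      | succ i => simp only [liftVar, key, h]; rfl

/-- Renaming of the free variables of a formula. -/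
def PForm.relabel {Γ : List L.Srt} (g : ∀ s, V s → W s) (φ : PForm L V Γ) : PForm L W Γ :=
  φ.subst fun s => Sum.map (g s) id

theorem PForm.sat_relabel (M : Structure.{u, w} L) {Γ : List L.Srt} (φ : PForm L V Γ)
    (g : ∀ s, V s → W s) (b : ∀ s, W s → M.Carrier s) (e : ∀ s, Var Γ s → M.Carrier s) :
    (φ.relabel g).Sat M b e ↔ φ.Sat M (fun s x => b s (g s x)) e := by
  refine φ.sat_subst M _ _ _ _ _ ?_
  rintro s (x | x) <;> rfl

theorem realize_relabel (M : Structure.{u, w} L) (φ : Formula L V)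
    (g : ∀ s, V s → W s) (b : ∀ s, W s → M.Carrier s) :
    Formula.Realize (PForm.relabel g φ) M b ↔ φ.Realize M (fun s x => b s (g s x)) :=
  PForm.sat_relabel M φ g b _

/-- The conjunction of a finite list of formulas. -/
def conj : List (Formula L V) → Formula L V
  | [] => .top
  | φ :: l => .and φ (conj l)

theorem realize_conj (M : Structure.{u, w} L) (a : ∀ s, V s → M.Carrier s)
    (l : List (Formula L V)) : (conj l).Realize M a ↔ ∀ φ ∈ l, φ.Realize M a := by
  induction l with
  | nil => simp [conj, Formula.Realize, PForm.Sat]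
  | cons φ l ih =>
    simp only [List.forall_mem_cons, ← ih]
    rfl

/-- Existential quantification over all pending variables. -/
def PForm.exs : ∀ {Γ : List L.Srt}, PForm L V Γ → Formula L V
  | [], φ => φ
  | _ :: _, φ => (PForm.ex _ φ).exs

theorem push_eta {S : Type u} {X : S → Type w} {s : S} {Γ : List S}
    (e : ∀ t, Var (s :: Γ) t → X t) : push (e s .zero) (fun t i => e t (.succ i)) = e := by
  funext t i
  cases i <;> rfl

theorem PForm.realize_exs (M : Structure.{u, w} L) (a : ∀ s, V s → M.Carrier s) :
    ∀ {Γ : List L.Srt} (φ : PForm L V Γ), φ.exs.Realize M a ↔ ∃ e, φ.Sat M a e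
  | [], φ => by
    refine ⟨fun h => ⟨_, h⟩, fun ⟨e, h⟩ => ?_⟩
    rwa [show e = nil from by funext t i; exact nomatch i] at h
  | s :: Γ, φ => by
    rw [PForm.exs, PForm.realize_exs M a]
    constructor
    · rintro ⟨e, m, h⟩
      exact ⟨_, h⟩
    · rintro ⟨e, h⟩
      refine ⟨fun t i => e t (.succ i), e s .zero, ?_⟩
      rwa [push_eta]

/-- The formula `∃ x φ(x, y)`, where `x` is a finite tuple. -/
def exTuple {Γ : List L.Srt} (φ : Formula L (fun s => Var Γ s ⊕ W s)) : Formula L W :=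
  (PForm.subst (Θ := Γ) (W := W) (fun s => Sum.elim Sum.swap (fun i : Var [] s => nomatch i)) φ).exs

theorem realize_exTuple (M : Structure.{u, w} L) {Γ : List L.Srt}
    (φ : Formula L (fun s => Var Γ s ⊕ W s)) (b : ∀ s, W s → M.Carrier s) :
    (exTuple φ).Realize M b ↔ ∃ x, φ.Realize M (join x b) := by
  rw [exTuple, PForm.realize_exs]
  refine exists_congr fun x => PForm.sat_subst M φ _ _ _ _ _ ?_
  rintro s ((y | y) | y)
  · rfl
  · rfl
  · exact nomatch y

end Formulas

/-! ### Formulas have finitely many variables -/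

section Support

instance finite_sigma_var {S : Type u} (Γ : List S) : Finite (Σ s, Var Γ s) := by
  induction Γ with
  | nil => exact @Finite.of_subsingleton _ ⟨fun x => nomatch x.2⟩
  | cons t Γ ih =>
    refine Finite.of_surjective
      (fun x : Option (Σ s, Var Γ s) => (x.elim ⟨t, .zero⟩ fun y => ⟨y.1, .succ y.2⟩ :
        Σ s, Var (t :: Γ) s)) ?_
    rintro ⟨s, i⟩
    cases i with
    | zero => exact ⟨none, rfl⟩
    | succ i => exact ⟨some ⟨_, i⟩, rfl⟩

/-- The tuple of variables enumerated by a list. -/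
def tupleOfList {S : Type u} {W : S → Type v} :
    ∀ (l : List (Σ s, W s)) (s : S), Var (l.map Sigma.fst) s → W s
  | x :: _, _, .zero => x.2
  | _ :: l, _, .succ i => tupleOfList l _ i

theorem tupleOfList_mem {S : Type u} {W : S → Type v} :
    ∀ (l : List (Σ s, W s)) (s : S) (i : Var (l.map Sigma.fst) s), ⟨s, tupleOfList l s i⟩ ∈ l
  | _ :: _, _, .zero => List.mem_cons_self
  | _ :: l, _, .succ i => List.mem_cons_of_mem _ (tupleOfList_mem l _ i)

theorem tupleOfList_surj {S : Type u} {W : S → Type v} :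
    ∀ (l : List (Σ s, W s)) (s : S) (y : W s), ⟨s, y⟩ ∈ l → ∃ i, tupleOfList l s i = y
  | x :: l, s, y, h => by
    rcases List.mem_cons.1 h with rfl | h
    · exact ⟨.zero, rfl⟩
    · obtain ⟨i, hi⟩ := tupleOfList_surj l s y h
      exact ⟨.succ i, hi⟩

theorem tupleOfList_inj {S : Type u} {W : S → Type v} :
    ∀ (l : List (Σ s, W s)), l.Nodup → ∀ s, Function.Injective (tupleOfList l s)
  | x :: l, hl, s, i, j, h => by
    have hx := (List.nodup_cons.1 hl).1
    cases i with
    | zero =>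
      generalize hj : j = j' at *
      cases j' with
      | zero => rfl
      | succ j =>
        have := tupleOfList_mem l _ j
        rw [show tupleOfList l _ j = x.2 from h.symm] at this
        exact absurd this hx
    | succ i =>
      cases j with
      | zero =>
        have := tupleOfList_mem l _ i
        rw [show tupleOfList l _ i = x.2 from h] at this
        exact absurd this hx
      | succ j =>
        exact congrArg _ (tupleOfList_inj l (List.nodup_cons.1 hl).2 _ h)

/-- Every finite family of variables is in bijection with the variables of a list of sorts. -/
theorem exists_var_equiv {S : Type u} (W : S → Type v) [Finite (Σ s, W s)] :
    ∃ Γ : List S, Nonempty (∀ s, Var Γ s ≃ W s) := by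
  classical
  cases nonempty_fintype (Σ s, W s)
  refine ⟨(Finset.univ.toList : List (Σ s, W s)).map Sigma.fst,
    ⟨fun s => Equiv.ofBijective (tupleOfList _ s) ⟨tupleOfList_inj _ ?_ s, fun y => ?_⟩⟩⟩
  · exact Finset.nodup_toList _
  · exact tupleOfList_surj _ s y (by simp)

variable {V : L.Srt → Type v}

/-- The variables that belong to a set `S`. -/
abbrev Sub (S : Set (Σ s, V s)) : L.Srt → Type v := fun s => {x : V s // (⟨s, x⟩ : Σ s, V s) ∈ S}

/-- A term uses finitely many of the variables `V`. The quantification over `S'` allows supports to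
be merged; terms are compared by their values, which avoids compositions of renamings. -/
theorem Term.exists_support {Γ : List L.Srt} {s : L.Srt}
    (t : Term L (fun r => V r ⊕ Var Γ r) s) :
    ∃ S : Set (Σ s, V s), S.Finite ∧ ∀ S', S ⊆ S' →
      ∃ t₀ : Term L (fun r => Sub S' r ⊕ Var Γ r) s,
      ∀ (M : Structure.{u, w} L) (a : ∀ s, V s → M.Carrier s) (e : ∀ s, Var Γ s → M.Carrier s),
        t.eval M (join a e) = t₀.eval M (join (fun s x => a s x.1) e) := by
  induction t with
  | @var s x =>
    rcases x with x | x
    · exact ⟨{⟨s, x⟩}, Set.finite_singleton _, fun S' h =>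
        ⟨.var (.inl ⟨x, h rfl⟩), fun M a e => rfl⟩⟩
    · exact ⟨∅, Set.finite_empty, fun S' h => ⟨.var (.inr x), fun M a e => rfl⟩⟩
  | @app l s f ts ih =>
    choose S hS h using ih
    refine ⟨⋃ z : Σ t, Var l t, S z.1 z.2, Set.finite_iUnion fun z => hS _ _, fun S' h' => ?_⟩
    choose t₀ ht₀ using fun t i =>
      h t i S' ((Set.subset_iUnion (fun z : Σ t, Var l t => S z.1 z.2) ⟨t, i⟩).trans h')
    refine ⟨.app f t₀, fun M a e => ?_⟩
    simp only [Term.eval, ht₀]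

/-- A formula uses finitely many of its free variables. -/
theorem PForm.exists_support {Γ : List L.Srt} (φ : PForm L V Γ) :
    ∃ S : Set (Σ s, V s), S.Finite ∧ ∀ S', S ⊆ S' →
      ∃ φ₀ : PForm L (Sub S') Γ,
      ∀ (M : Structure.{u, w} L) (a : ∀ s, V s → M.Carrier s) (e : ∀ s, Var Γ s → M.Carrier s),
        φ.Sat M a e ↔ φ₀.Sat M (fun s x => a s x.1) e := by
  induction φ with
  | top => exact ⟨∅, Set.finite_empty, fun S' _ => ⟨.top, fun _ _ _ => Iff.rfl⟩⟩
  | bot => exact ⟨∅, Set.finite_empty, fun S' _ => ⟨.bot, fun _ _ _ => Iff.rfl⟩⟩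
  | eq t₁ t₂ =>
    obtain ⟨S₁, f₁, h₁⟩ := Term.exists_support.{u, v, w} t₁
    obtain ⟨S₂, f₂, h₂⟩ := Term.exists_support.{u, v, w} t₂
    refine ⟨S₁ ∪ S₂, f₁.union f₂, fun S' h => ?_⟩
    obtain ⟨u₁, hu₁⟩ := h₁ S' (Set.subset_union_left.trans h)
    obtain ⟨u₂, hu₂⟩ := h₂ S' (Set.subset_union_right.trans h)
    exact ⟨.eq u₁ u₂, fun M a e => by simp only [PForm.Sat, hu₁, hu₂]⟩
  | @rel Γ l R ts =>
    choose S hS h using fun t i => Term.exists_support.{u, v, w} (ts t i)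
    refine ⟨⋃ z : Σ t, Var l t, S z.1 z.2, Set.finite_iUnion fun z => hS _ _, fun S' h' => ?_⟩
    choose t₀ ht₀ using fun t i =>
      h t i S' ((Set.subset_iUnion (fun z : Σ t, Var l t => S z.1 z.2) ⟨t, i⟩).trans h')
    exact ⟨.rel R t₀, fun M a e => by simp only [PForm.Sat, ht₀]⟩
  | and φ₁ φ₂ ih₁ ih₂ =>
    obtain ⟨S₁, f₁, h₁⟩ := ih₁
    obtain ⟨S₂, f₂, h₂⟩ := ih₂
    refine ⟨S₁ ∪ S₂, f₁.union f₂, fun S' h => ?_⟩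
    obtain ⟨u₁, hu₁⟩ := h₁ S' (Set.subset_union_left.trans h)
    obtain ⟨u₂, hu₂⟩ := h₂ S' (Set.subset_union_right.trans h)
    exact ⟨.and u₁ u₂, fun M a e => by simp only [PForm.Sat, hu₁, hu₂]⟩
  | or φ₁ φ₂ ih₁ ih₂ =>
    obtain ⟨S₁, f₁, h₁⟩ := ih₁
    obtain ⟨S₂, f₂, h₂⟩ := ih₂
    refine ⟨S₁ ∪ S₂, f₁.union f₂, fun S' h => ?_⟩
    obtain ⟨u₁, hu₁⟩ := h₁ S' (Set.subset_union_left.trans h)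
    obtain ⟨u₂, hu₂⟩ := h₂ S' (Set.subset_union_right.trans h)
    exact ⟨.or u₁ u₂, fun M a e => by simp only [PForm.Sat, hu₁, hu₂]⟩
  | ex s φ ih =>
    obtain ⟨S, f, h⟩ := ih
    refine ⟨S, f, fun S' h' => ?_⟩
    obtain ⟨φ₀, h₀⟩ := h S' h'
    exact ⟨.ex s φ₀, fun M a e => exists_congr fun m => h₀ M a _⟩

/-- A formula is a formula in a finite tuple of variables. -/
theorem exists_finite_tuple (φ : Formula L V) :
    ∃ (Γ : List L.Srt) (g : ∀ s, Var Γ s → V s) (φ₀ : Formula L (Var Γ)),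
      ∀ (M : Structure.{u, w} L) (a : ∀ s, V s → M.Carrier s),
        φ.Realize M a ↔ φ₀.Realize M (fun s x => a s (g s x)) := by
  obtain ⟨S, hS, h⟩ := PForm.exists_support.{u, _, w} φ
  obtain ⟨φ₀, h₀⟩ := h S subset_rfl
  have : Finite (Σ s, Sub S s) := by
    have := hS.to_subtype
    refine Finite.of_injective (β := S) (fun x => ⟨⟨x.1, x.2.1⟩, x.2.2⟩) ?_
    rintro ⟨s, x, hx⟩ ⟨t, y, hy⟩ h
    obtain ⟨rfl, h⟩ := Sigma.mk.inj_iff.1 (Subtype.mk.inj h)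
    cases h
    rfl
  obtain ⟨Γ, ⟨E⟩⟩ := exists_var_equiv (Sub S)
  refine ⟨Γ, fun s x => (E s x).1, PForm.relabel (fun s x => (E s).symm x) φ₀, fun M a => ?_⟩
  rw [realize_relabel]
  simp only [Equiv.apply_symm_apply]
  exact h₀ M a _

/-- A formula in two tuples `x`, `y` of variables is a formula in finite tuples of distinct
variables from `x` and `y`. -/
theorem exists_finite_tuples {W : L.Srt → Type v'} (φ : Formula L (fun s => V s ⊕ W s)) :
    ∃ (Γ Δ : List L.Srt) (g : ∀ s, Var Γ s → V s) (h : ∀ s, Var Δ s → W s)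
      (φ₀ : Formula L (fun s => Var Γ s ⊕ Var Δ s)), (∀ s, Function.Injective (g s)) ∧
      ∀ (M : Structure.{u, w} L) (a : ∀ s, V s → M.Carrier s) (b : ∀ s, W s → M.Carrier s),
        φ.Realize M (join a b) ↔
          φ₀.Realize M (join (fun s x => a s (g s x)) (fun s x => b s (h s x))) := by
  obtain ⟨S, hS, h⟩ := PForm.exists_support.{u, _, w} φ
  obtain ⟨φ₀, h₀⟩ := h S subset_rfl
  have := hS.to_subtype
  have h₁ : Finite (Σ s, {x : V s // (⟨s, .inl x⟩ : Σ s, V s ⊕ W s) ∈ S}) := by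
    refine Finite.of_injective (β := S) (fun x => ⟨⟨x.1, .inl x.2.1⟩, x.2.2⟩) ?_
    rintro ⟨s, x, hx⟩ ⟨t, y, hy⟩ h
    obtain ⟨rfl, h⟩ := Sigma.mk.inj_iff.1 (Subtype.mk.inj h)
    cases h
    rfl
  have h₂ : Finite (Σ s, {x : W s // (⟨s, .inr x⟩ : Σ s, V s ⊕ W s) ∈ S}) := by
    refine Finite.of_injective (β := S) (fun x => ⟨⟨x.1, .inr x.2.1⟩, x.2.2⟩) ?_
    rintro ⟨s, x, hx⟩ ⟨t, y, hy⟩ h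
    obtain ⟨rfl, h⟩ := Sigma.mk.inj_iff.1 (Subtype.mk.inj h)
    cases h
    rfl
  obtain ⟨Γ, ⟨E⟩⟩ := exists_var_equiv fun s => {x : V s // (⟨s, .inl x⟩ : Σ s, V s ⊕ W s) ∈ S}
  obtain ⟨Δ, ⟨F⟩⟩ := exists_var_equiv fun s => {x : W s // (⟨s, .inr x⟩ : Σ s, V s ⊕ W s) ∈ S}
  let ρ : ∀ s, Sub S s → Var Γ s ⊕ Var Δ s := fun s x => match x with
    | ⟨.inl x, hx⟩ => .inl ((E s).symm ⟨x, hx⟩)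
    | ⟨.inr x, hx⟩ => .inr ((F s).symm ⟨x, hx⟩)
  refine ⟨Γ, Δ, fun s x => (E s x).1, fun s x => (F s x).1, PForm.relabel ρ φ₀,
    fun s => Subtype.val_injective.comp (E s).injective, fun M a b => ?_⟩
  rw [realize_relabel]
  refine (h₀ M _ _).trans (iff_of_eq ?_)
  congr 1
  funext s x
  rcases x with ⟨x | x, hx⟩ <;> simp [ρ, join]

end Support

/-! ### The Erdős–Rado partition property -/

section ErdosRado

variable {O N K : Type u} [LinearOrder O] [LinearOrder N] {n : ℕ}

/-- For a colouring `c` of `n + 1`-tuples, the elements above the values of `e` below `α` that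
cannot be distinguished from `y` by means of these values. -/
def endCandidates (c : (Fin (n + 1) → O) → K) (y : O) (α : N) (e : N → O) : Set O :=
  {x | (∀ β < α, e β < x) ∧ ∀ i : Fin n → N, (∀ j, i j < α) →
    c (Fin.snoc (e ∘ i) x) = c (Fin.snoc (e ∘ i) y)}

theorem endCandidates_congr (c : (Fin (n + 1) → O) → K) (y y' : O) (α : N) (e e' : N → O)
    (h : ∀ β < α, e β = e' β)
    (hy : ∀ i : Fin n → N, (∀ j, i j < α) →
      c (Fin.snoc (e ∘ i) y) = c (Fin.snoc (e' ∘ i) y')) :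
    endCandidates c y α e = endCandidates c y' α e' := by
  ext x
  refine and_congr (forall₂_congr fun β hβ => by rw [h β hβ]) (forall₂_congr fun i hi => ?_)
  rw [hy i hi, show e ∘ i = e' ∘ i from funext fun j => h _ (hi j)]

variable [WellFoundedLT O] [WellFoundedLT N]

/-- The sequence whose next term is the least element that cannot be distinguished from `y` by
means of the earlier terms; it stays at `y` once `y` is reached. -/
noncomputable def endSeq (c : (Fin (n + 1) → O) → K) (y : O) : N → O :=
  wellFounded_lt.fix fun α e => wellFounded_lt.min
    (insert y (endCandidates c y α fun β => open Classical in if h : β < α then e β h else y))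
    ⟨y, Set.mem_insert _ _⟩

theorem endSeq_eq (c : (Fin (n + 1) → O) → K) (y : O) (α : N) :
    endSeq c y α = wellFounded_lt.min (insert y (endCandidates c y α (endSeq c y)))
      ⟨y, Set.mem_insert _ _⟩ := by
  rw [endSeq, WellFounded.fix_eq]
  congr 2
  refine endCandidates_congr c y y α _ _ (fun β hβ => ?_) (fun i hi => ?_)
  · simp [hβ]
  · congr 2
    funext j
    simp [hi j]

theorem endSeq_mem (c : (Fin (n + 1) → O) → K) (y : O) (α : N) :
    endSeq c y α ∈ insert y (endCandidates c y α (endSeq c y)) := by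
  rw [endSeq_eq]
  exact WellFounded.min_mem _ _ _

theorem endSeq_le (c : (Fin (n + 1) → O) → K) (y : O) (α : N) {x : O}
    (hx : x ∈ insert y (endCandidates c y α (endSeq c y))) : endSeq c y α ≤ x := by
  rw [endSeq_eq]
  exact not_lt.1 (WellFounded.not_lt_min _ _ hx)

/-- If the sequences of `y` and `y'` reach `y` and `y'` at the same place, with the same
colours before, then `y = y'`. -/
theorem eq_of_endSeq (c : (Fin (n + 1) → O) → K) (y y' : O) (α : N)
    (h : endSeq c y α = y) (hlt : ∀ β < α, endSeq c y β < y)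
    (h' : endSeq c y' α = y') (hlt' : ∀ β < α, endSeq c y' β < y')
    (hc : ∀ i : Fin n → N, c (Fin.snoc (endSeq c y ∘ i) y) = c (Fin.snoc (endSeq c y' ∘ i) y')) :
    y = y' := by
  have key : ∀ β, β ≤ α → endSeq c y β = endSeq c y' β := by
    intro β
    induction β using WellFoundedLT.induction with
    | ind β ih =>
    intro hβ
    have hS : endCandidates c y β (endSeq c y) = endCandidates c y' β (endSeq c y') :=
      endCandidates_congr c y y' β _ _ (fun γ hγ => ih γ hγ (hγ.le.trans hβ)) fun i _ => hc i
    -- the term at `β` belongs to the candidates themselves, not only to `y` and the candidates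
    have mem : ∀ z : O, endSeq c z α = z → (∀ β < α, endSeq c z β < z) →
        endSeq c z β ∈ endCandidates c z β (endSeq c z) := by
      intro z hz hzlt
      rcases hβ.lt_or_eq with hβ | rfl
      · exact (endSeq_mem c z β).resolve_left (hzlt β hβ).ne
      · rw [hz]
        exact ⟨hzlt, fun _ _ => rfl⟩
    refine le_antisymm (endSeq_le c y β (.inr ?_)) (endSeq_le c y' β (.inr ?_))
    · rw [hS]
      exact mem y' h' hlt'
    · rw [← hS]
      exact mem y h hlt
  rw [← h, ← h']
  exact key α le_rfl

/-- If `O` is large, some sequence is end-homogeneous: the colour of an increasing tuple does not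
depend on the last entry. -/
theorem exists_endSeq_lt (hO : Cardinal.mk (N × ((Fin n → N) → K)) < Cardinal.mk O)
    (c : (Fin (n + 1) → O) → K) : ∃ y : O, ∀ α : N, endSeq c y α < y := by
  by_contra! hcon
  have hex : ∀ y : O, ∃ α : N, endSeq c y α = y ∧ ∀ β < α, endSeq c y β < y := by
    intro y
    obtain ⟨α, hα, hmin⟩ := WellFounded.has_min (wellFounded_lt (α := N))
      {α | y ≤ endSeq c y α} (hcon y)
    exact ⟨α, le_antisymm (endSeq_le c y α (Set.mem_insert _ _)) hα,
      fun β hβ => not_le.1 fun h => hmin β h hβ⟩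
  choose α hα hlt using hex
  refine hO.not_ge (Cardinal.mk_le_of_injective
    (f := fun y => (α y, fun i : Fin n → N => c (Fin.snoc (endSeq c y ∘ i) y))) ?_)
  intro y y' h
  obtain ⟨h₁, h₂⟩ := Prod.mk.inj h
  refine eq_of_endSeq c y y' (α y) (hα y) (hlt y) ?_ ?_ (fun i => congrFun h₂ i)
  · rw [h₁]; exact hα y'
  · rw [h₁]; exact hlt y'

/-- The partition property: a colouring of the increasing `n`-tuples of a sufficiently large
well-order has a homogeneous subset of a prescribed order type. -/
theorem erdos_rado (n : ℕ) (K : Type u) : ∀ (N : Type u) [LinearOrder N] [WellFoundedLT N],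
    ∃ (O : Type u) (_ : LinearOrder O) (_ : WellFoundedLT O), ∀ c : (Fin n → O) → K,
      ∃ f : N → O, StrictMono f ∧ ∀ i j : Fin n → N, StrictMono i → StrictMono j →
        c (f ∘ i) = c (f ∘ j) := by
  induction n with
  | zero =>
    intro N _ _
    exact ⟨N, inferInstance, inferInstance, fun c => ⟨id, strictMono_id, fun i j _ _ => by
      rw [Subsingleton.elim i j]⟩⟩
  | succ n ih =>
    intro N _ _
    obtain ⟨Q, _, _, hQ⟩ := ih N
    let κ := Order.succ (Cardinal.mk (Q × ((Fin n → Q) → K)))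
    refine ⟨κ.ord.ToType, inferInstance, inferInstance, fun c => ?_⟩
    have hκ : Cardinal.mk (Q × ((Fin n → Q) → K)) < Cardinal.mk κ.ord.ToType := by
      rw [Cardinal.mk_ord_toType]
      exact Order.lt_succ _
    obtain ⟨y, hy⟩ := exists_endSeq_lt hκ c
    have hmem : ∀ α : Q, endSeq c y α ∈ endCandidates c y α (endSeq c y) := fun α =>
      (endSeq_mem c y α).resolve_left (hy α).ne
    obtain ⟨f, hf, hom⟩ := hQ fun i => c (Fin.snoc (endSeq c y ∘ i) y)
    have hmono : StrictMono (endSeq c y : Q → _) := fun β α h => (hmem α).1 β h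
    refine ⟨endSeq c y ∘ f, hmono.comp hf, ?_⟩
    have key : ∀ i : Fin (n + 1) → N, StrictMono i → c ((endSeq c y ∘ f) ∘ i) =
        c (Fin.snoc (endSeq c y ∘ (f ∘ fun j : Fin n => i j.castSucc)) y) := by
      intro i hi
      refine Eq.trans ?_ ((hmem (f (i (Fin.last n)))).2 (f ∘ fun j : Fin n => i j.castSucc)
        fun j => hf (hi (Fin.castSucc_lt_last j)))
      congr 1
      funext j
      refine Fin.lastCases ?_ (fun j => ?_) j
      · simp
      · simp
    intro i j hi hj
    rw [key i hi, key j hj]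
    exact hom _ _ (hi.comp Fin.strictMono_castSucc) (hj.comp Fin.strictMono_castSucc)

end ErdosRado

/-! ### Types in the monster model -/

section Types

variable {T : Theory L} {M : Structure.{u, u + 1} L} {V : L.Srt → Type v} {W : L.Srt → Type v'}

theorem IsPC.exists_obstruction (hM : IsPC T M) (φ : Formula L V) (a : ∀ s, V s → M.Carrier s)
    (h : ¬ φ.Realize M a) : ∃ ψ : Formula L V, IsObstruction T φ ψ ∧ ψ.Realize M a := by
  obtain ⟨Γ, g, φ₀, h₀⟩ := exists_finite_tuple.{u, v, u + 1} φ
  obtain ⟨ψ₀, hψ, hψa⟩ := hM.2 Γ φ₀ _ (mt (h₀ M a).2 h)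
  refine ⟨PForm.relabel g ψ₀, fun N hN => ?_, (realize_relabel M _ _ _).2 hψa⟩
  rintro ⟨b, hb, hb'⟩
  exact hψ N hN ⟨_, (h₀ N b).1 hb, (realize_relabel N _ _ _).1 hb'⟩

/-- Two tuples have the same type over the empty set. For the type over the elements of a tuple
`p`, this is applied to the tuples extended by `p`. -/
def TypeEq (M : Structure.{u, w} L) (a b : ∀ s, V s → M.Carrier s) : Prop :=
  ∀ φ : Formula L V, φ.Realize M a ↔ φ.Realize M b

theorem TypeEq.symm {a b : ∀ s, V s → M.Carrier s} (h : TypeEq M a b) : TypeEq M b a :=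
  fun φ => (h φ).symm

theorem TypeEq.trans {a b c : ∀ s, V s → M.Carrier s} (h : TypeEq M a b) (h' : TypeEq M b c) :
    TypeEq M a c := fun φ => (h φ).trans (h' φ)

theorem TypeEq.comp {a b : ∀ s, V s → M.Carrier s} (h : TypeEq M a b) (g : ∀ s, W s → V s)
    {a' b' : ∀ s, W s → M.Carrier s} (ha : ∀ s x, a' s x = a s (g s x))
    (hb : ∀ s x, b' s x = b s (g s x)) : TypeEq M a' b' := by
  obtain rfl : a' = fun s x => a s (g s x) := funext fun s => funext (ha s)
  obtain rfl : b' = fun s x => b s (g s x) := funext fun s => funext (hb s)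
  intro φ
  exact (realize_relabel M φ g a).symm.trans ((h _).trans (realize_relabel M φ g b))

/-- Types in a positively closed model are maximal. -/
theorem IsPC.typeEq_of_imp (hM : IsPC T M) {a b : ∀ s, V s → M.Carrier s}
    (h : ∀ φ : Formula L V, φ.Realize M a → φ.Realize M b) : TypeEq M a b := by
  refine fun φ => ⟨h φ, fun hb => ?_⟩
  by_contra ha
  obtain ⟨ψ, hψ, hψa⟩ := hM.exists_obstruction φ a ha
  exact hψ M hM.1 ⟨b, hb, h ψ hψa⟩

theorem Term.eval_auto (f : Auto M) (a : ∀ s, V s → M.Carrier s) {s : L.Srt} (t : Term L V s) :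
    t.eval M (fun s x => f.map s (a s x)) = f.map s (t.eval M a) := by
  induction t with
  | var x => rfl
  | app g ts ih => simp only [Term.eval, ih, f.map_func]

theorem PForm.sat_auto (f : Auto M) (a : ∀ s, V s → M.Carrier s) {Γ : List L.Srt}
    (φ : PForm L V Γ) : ∀ e : ∀ s, Var Γ s → M.Carrier s,
      φ.Sat M (fun s x => f.map s (a s x)) (fun s x => f.map s (e s x)) ↔ φ.Sat M a e := by
  have hj : ∀ {Γ : List L.Srt} (e : ∀ s, Var Γ s → M.Carrier s),
      join (fun s x => f.map s (a s x)) (fun s x => f.map s (e s x)) =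
        fun s x => f.map s (join a e s x) := by
    intro Γ e
    funext s x
    rcases x with x | x <;> rfl
  induction φ with
  | top => exact fun _ => Iff.rfl
  | bot => exact fun _ => Iff.rfl
  | eq t₁ t₂ =>
    intro e
    simp only [PForm.Sat, hj, Term.eval_auto]
    exact (f.bijective _).1.eq_iff
  | rel R ts =>
    intro e
    simp only [PForm.Sat, hj, Term.eval_auto]
    exact ⟨f.reflects R _, f.map_rel R _⟩
  | and φ ψ ih₁ ih₂ => exact fun e => and_congr (ih₁ e) (ih₂ e)
  | or φ ψ ih₁ ih₂ => exact fun e => or_congr (ih₁ e) (ih₂ e)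
  | @ex Γ s φ ih =>
    intro e
    have hp : ∀ m, push (f.map s m) (fun s x => f.map s (e s x)) =
        fun t x => f.map t (push m e t x) := by
      intro m
      funext t x
      cases x <;> rfl
    refine ((f.bijective s).2.exists).trans (exists_congr fun m => ?_)
    rw [hp]
    exact ih _

theorem Auto.typeEq (f : Auto M) (a : ∀ s, V s → M.Carrier s) :
    TypeEq M a (fun s x => f.map s (a s x)) := by
  intro φ
  refine (PForm.sat_auto f a φ nil).symm.trans (iff_of_eq ?_)
  exact congrArg _ (funext fun t => funext fun i => nomatch i)

/-- A small family can be indexed by a family of types in the universe `u`. -/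
theorem exists_equiv_family {S : Type u} (I : S → Type v) [Small.{u} (Σ s, I s)] :
    ∃ J : S → Type u, Nonempty (∀ s, I s ≃ J s) := by
  have : ∀ s, Small.{u} (I s) := fun s =>
    small_of_injective (β := Σ s, I s) (f := Sigma.mk s) sigma_mk_injective
  exact ⟨fun s => Shrink.{u} (I s), ⟨fun s => equivShrink _⟩⟩

instance small_sigma_sum {S : Type u} (I : S → Type v) (J : S → Type v')
    [Small.{u} (Σ s, I s)] [Small.{u} (Σ s, J s)] : Small.{u} (Σ s, I s ⊕ J s) := by
  refine small_of_injective (β := (Σ s, I s) ⊕ (Σ s, J s))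
    (f := fun x => x.2.elim (fun y => .inl ⟨x.1, y⟩) fun y => .inr ⟨x.1, y⟩) ?_
  rintro ⟨s, x | x⟩ ⟨t, y | y⟩ h <;> simp at h <;> obtain ⟨rfl, h⟩ := h <;> cases h <;> rfl

instance small_sigma_prod {S : Type u} {D : Type} (I : S → Type v)
    [Small.{u} (Σ s, I s)] : Small.{u} (Σ s, D × I s) := by
  refine small_of_injective (β := D × (Σ s, I s)) (f := fun x => (x.2.1, ⟨x.1, x.2.2⟩)) ?_
  rintro ⟨s, x, x'⟩ ⟨t, y, y'⟩ h
  simp at h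
  obtain ⟨rfl, rfl, h⟩ := h
  cases h
  rfl

theorem IsMonster.exists_auto (hM : IsMonster T M) {I : L.Srt → Type v} [Small.{u} (Σ s, I s)]
    {a b : ∀ s, I s → M.Carrier s} (h : TypeEq M a b) :
    ∃ f : Auto M, ∀ s i, f.map s (a s i) = b s i := by
  obtain ⟨J, ⟨E⟩⟩ := exists_equiv_family I
  obtain ⟨f, hf⟩ := hM.homogeneous J (fun s j => a s ((E s).symm j)) (fun s j => b s ((E s).symm j))
    (h.comp (fun s => Sum.elim (E s).symm fun x => x.2.elim) (by rintro s (x | ⟨x, ⟨⟩⟩); rfl)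
      (by rintro s (x | ⟨x, ⟨⟩⟩); rfl))
  exact ⟨f, fun s i => by simpa using hf s (E s i)⟩

/-- Tuples of the same type over `C` are conjugate by an automorphism that fixes `C`. -/
theorem IsMonster.exists_auto_over (hM : IsMonster T M) {I : L.Srt → Type v}
    [Small.{u} (Σ s, I s)] {C : Elems M} (hC : C.IsSmall) {a b : ∀ s, I s → M.Carrier s}
    (h : SameType M C a b) :
    ∃ f : Auto M, (∀ s i, f.map s (a s i) = b s i) ∧ ∀ s, ∀ m ∈ C s, f.map s m = m := by
  have : Small.{u} (Σ s, C s) := hC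
  obtain ⟨f, hf⟩ := hM.exists_auto (I := fun s => I s ⊕ C s) h
  exact ⟨f, fun s i => hf s (.inl i), fun s m hm => hf s (.inr ⟨m, hm⟩)⟩

theorem sameType_of_auto (f : Auto M) {C : Elems M} (hf : ∀ s, ∀ m ∈ C s, f.map s m = m)
    {I : L.Srt → Type v} (a : ∀ s, I s → M.Carrier s) :
    SameType M C a (fun s i => f.map s (a s i)) := by
  refine (f.typeEq (join a C.tuple)).comp (fun _ => id) (fun _ _ => rfl) ?_
  rintro s (x | x)
  · rfl
  · exact (hf s _ x.2).symm

theorem SameType.mono {C C' : Elems M} (h : C' ≤ C) {I : L.Srt → Type v}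
    {a b : ∀ s, I s → M.Carrier s} (hab : SameType M C a b) : SameType M C' a b :=
  TypeEq.comp hab (fun s => Sum.map id fun x => ⟨x.1, h s x.2⟩)
    (by rintro s (x | x) <;> rfl) (by rintro s (x | x) <;> rfl)

theorem sameType_of_typeEq {I : L.Srt → Type v} {P : L.Srt → Type v'}
    {a b : ∀ s, I s → M.Carrier s} {p : ∀ s, P s → M.Carrier s} {C : Elems M}
    (hC : ∀ s, ∀ m ∈ C s, ∃ i, p s i = m) (h : TypeEq M (join a p) (join b p)) :
    SameType M C a b := by
  choose g hg using hC
  refine h.comp (fun s => Sum.map id fun x => g s x.1 x.2) ?_ ?_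
  all_goals
    rintro s (x | x)
    · rfl
    · exact (hg s _ x.2).symm

/-- Saturation for small tuples that are indexed by arbitrary types. -/
theorem IsMonster.compactness (hM : IsMonster T M) {X : L.Srt → Type v} {P : L.Srt → Type v'}
    [Small.{u} (Σ s, X s)] [Small.{u} (Σ s, P s)] (p : ∀ s, P s → M.Carrier s)
    (Φ : Set (Formula L (fun s => X s ⊕ P s)))
    (h : ∀ Φ₀ ⊆ Φ, Φ₀.Finite →
      ∃ a : ∀ s, X s → M.Carrier s, ∀ φ ∈ Φ₀, φ.Realize M (join a p)) :
    ∃ a : ∀ s, X s → M.Carrier s, ∀ φ ∈ Φ, φ.Realize M (join a p) := by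
  obtain ⟨X', ⟨E⟩⟩ := exists_equiv_family X
  obtain ⟨P', ⟨F⟩⟩ := exists_equiv_family P
  let ρ : Formula L (fun s => X s ⊕ P s) → Formula L (fun s => X' s ⊕ P' s) :=
    PForm.relabel fun s => Sum.map (E s) (F s)
  have hρ : ∀ (a : ∀ s, X' s → M.Carrier s) φ,
      (ρ φ).Realize M (join a fun s x => p s ((F s).symm x)) ↔
        φ.Realize M (join (fun s x => a s (E s x)) p) := by
    intro a φ
    refine (realize_relabel M _ _ _).trans (iff_of_eq (congrArg _ ?_))
    funext s x
    rcases x with x | x <;> simp [join]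
  obtain ⟨a, ha⟩ := hM.saturated X' P' (fun s x => p s ((F s).symm x)) (ρ '' Φ) (by
    intro Φ₁ h₁ hfin
    obtain ⟨Φ₀, hΦ, hfin₀, rfl⟩ :=
      Set.exists_subset_image_finite_and (p := (· = Φ₁)).1 ⟨Φ₁, h₁, hfin, rfl⟩
    obtain ⟨a, ha⟩ := h Φ₀ hΦ hfin₀
    refine ⟨fun s x => a s ((E s).symm x), ?_⟩
    rintro _ ⟨φ, hφ, rfl⟩
    rw [hρ]
    simpa using ha φ hφ)
  exact ⟨fun s x => a s (E s x), fun φ hφ => (hρ a φ).1 (ha _ ⟨φ, hφ, rfl⟩)⟩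

end Types

/-! ### Indiscernible sequences -/

section Indiscernibles

variable {T : Theory L} {M : Structure.{u, u + 1} L} {I P : L.Srt → Type u}

/-- A set of formulas `θ(x₁, …, xₙ, p)`, with `n` varying, whose variables stand for increasing
tuples from a sequence. -/
abbrev SeqType (I P : L.Srt → Type u) : Type u :=
  Set (Σ n : ℕ, Formula L (fun s => (Fin n × I s) ⊕ P s))

/-- The sequence `b`, indexed by a linear order, realizes all `θ(x₁, …, xₙ, p)` in `E` at all
increasing tuples. -/
def RealizesSeq (p : ∀ s, P s → M.Carrier s) (E : SeqType I P) {O : Type v} [LinearOrder O]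
    (b : O → ∀ s, I s → M.Carrier s) : Prop :=
  ∀ x ∈ E, ∀ i : Fin x.1 → O, StrictMono i →
    x.2.Realize M (join (fun s z => b (i z.1) s z.2) p)

theorem exists_strictMonoOn {O : Type v} [LinearOrder O] {S : Set O} (hS : S.Finite) :
    ∃ r : O → ℕ, StrictMonoOn r S := by
  classical
  refine ⟨fun x => (hS.toFinset.filter (· < x)).card, fun x hx y hy hxy => ?_⟩
  refine Finset.card_lt_card ⟨fun z hz => ?_, fun h => ?_⟩
  · rw [Finset.mem_filter] at hz ⊢
    exact ⟨hz.1, hz.2.trans hxy⟩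
  · have := h (Finset.mem_filter.2 ⟨hS.mem_toFinset.2 hx, hxy⟩)
    exact lt_irrefl _ (Finset.mem_filter.1 this).2

theorem IsMonster.realizesSeq_of_finite (hM : IsMonster T M) (p : ∀ s, P s → M.Carrier s)
    {E : SeqType I P}
    (hE : ∀ E₀ ⊆ E, E₀.Finite → ∃ b : ℕ → ∀ s, I s → M.Carrier s, RealizesSeq p E₀ b)
    (O : Type u) [LinearOrder O] :
    ∃ b : O → ∀ s, I s → M.Carrier s, RealizesSeq p E b := by
  let ρ : (Σ x : E, Fin x.1.1 → O) → Formula L (fun s => (O × I s) ⊕ P s) := fun x =>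
    PForm.relabel (fun s => Sum.map (fun z => (x.2 z.1, z.2)) id) x.1.1.2
  have hρ : ∀ x (a : ∀ s, O × I s → M.Carrier s), (ρ x).Realize M (join a p) ↔
      x.1.1.2.Realize M (join (fun s z => a s (x.2 z.1, z.2)) p) := by
    intro x a
    refine (realize_relabel M _ _ _).trans (iff_of_eq (congrArg _ ?_))
    funext s x
    rcases x with x | x <;> rfl
  obtain ⟨a, ha⟩ := hM.saturated (fun s => O × I s) P p (ρ '' {x | StrictMono x.2}) (by
    intro Φ₁ h₁ hfin
    obtain ⟨S, hS, hfinS, rfl⟩ :=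
      Set.exists_subset_image_finite_and (p := (· = Φ₁)).1 ⟨Φ₁, h₁, hfin, rfl⟩
    obtain ⟨b, hb⟩ := hE ((fun x => x.1.1) '' S) (by rintro _ ⟨x, -, rfl⟩; exact x.1.2)
      (hfinS.image _)
    obtain ⟨r, hr⟩ := exists_strictMonoOn (S := ⋃ x ∈ S, Set.range x.2)
      (hfinS.biUnion fun x _ => Set.finite_range _)
    refine ⟨fun s z => b (r z.1) s z.2, ?_⟩
    rintro _ ⟨x, hx, rfl⟩
    rw [hρ]
    refine hb _ ⟨x, hx, rfl⟩ (r ∘ x.2) fun j k hjk => ?_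
    exact hr (Set.mem_biUnion hx ⟨j, rfl⟩) (Set.mem_biUnion hx ⟨k, rfl⟩) (hS hx hjk))
  exact ⟨fun o s z => a s (o, z), fun x hx i hi => (hρ ⟨⟨x, hx⟩, i⟩ a).1 (ha _ ⟨_, hi, rfl⟩)⟩

/-- The sequence `b` stays a realization if the index set is thinned out. -/
theorem RealizesSeq.comp {p : ∀ s, P s → M.Carrier s} {E : SeqType I P} {O : Type v}
    [LinearOrder O] {b : O → ∀ s, I s → M.Carrier s} (h : RealizesSeq p E b) {O' : Type v'}
    [LinearOrder O'] {f : O' → O} (hf : StrictMono f) : RealizesSeq p E (b ∘ f) :=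
  fun x hx i hi => h x hx (f ∘ i) (hf.comp hi)

/-- Indiscernible sequences can be extracted: every sequence `B` gives rise to a sequence that is
indiscernible over `p` and satisfies at its increasing tuples every formula that `B` satisfies at
all its increasing tuples. For a maximal such set of formulas, the partition property, with the
obstructions of a formula as colours, shows that each formula or one of its obstructions
belongs to the set. -/
theorem IsMonster.exists_indiscernible (hM : IsMonster T M) (p : ∀ s, P s → M.Carrier s)
    (B : ℕ → ∀ s, I s → M.Carrier s) :
    ∃ b : ℕ → ∀ s, I s → M.Carrier s,
      (∀ (n : ℕ) (i j : Fin n → ℕ), StrictMono i → StrictMono j →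
        TypeEq M (join (concat b i) p) (join (concat b j) p)) ∧
      ∀ (n : ℕ) (θ : Formula L (fun s => (Fin n × I s) ⊕ P s)),
        (∀ i : Fin n → ℕ, StrictMono i → θ.Realize M (join (concat B i) p)) →
          ∀ i : Fin n → ℕ, StrictMono i → θ.Realize M (join (concat b i) p) := by
  let F : Set (SeqType I P) := {E | ∀ E₀ ⊆ E, E₀.Finite →
    ∃ b : ℕ → ∀ s, I s → M.Carrier s, RealizesSeq p E₀ b}
  have hF : Order.IsOfFiniteCharacter F := fun E =>
    ⟨fun h E₁ h₁ _ E₀ h₀ => h E₀ (h₀.trans h₁), fun h E₀ h₀ hfin => h E₀ h₀ hfin E₀ subset_rfl hfin⟩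
  have hFB : ∀ (E : SeqType I P) (b : ℕ → ∀ s, I s → M.Carrier s), RealizesSeq p E b → E ∈ F :=
    fun E b hb E₀ h₀ _ => ⟨b, fun x hx => hb x (h₀ hx)⟩
  let EB : SeqType I P := {x | ∀ i : Fin x.1 → ℕ, StrictMono i →
    x.2.Realize M (join (concat B i) p)}
  obtain ⟨E, hBE, hEF, hmax⟩ := hF.exists_maximal (hFB EB B fun x hx => hx)
  have hadd : ∀ (x) (b : ℕ → ∀ s, I s → M.Carrier s), RealizesSeq p E b →
      (∀ i : Fin x.1 → ℕ, StrictMono i → x.2.Realize M (join (concat b i) p)) → x ∈ E := by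
    intro x b hb hx
    refine hmax (hFB (insert x E) b ?_) (Set.subset_insert x E) (Set.mem_insert x E)
    rintro y (rfl | hy)
    · exact hx
    · exact hb y hy
  -- `E` is complete: it contains every formula or one of its obstructions
  have hcompl : ∀ (n : ℕ) (θ : Formula L (fun s => (Fin n × I s) ⊕ P s)),
      ⟨n, θ⟩ ∈ E ∨ ∃ ρ, IsObstruction T θ ρ ∧ ⟨n, ρ⟩ ∈ E := by
    classical
    intro n θ
    obtain ⟨O, _, _, hO⟩ := erdos_rado n (Option (Formula L (fun s => (Fin n × I s) ⊕ P s)))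
      (ULift.{u} ℕ)
    obtain ⟨b, hb⟩ := hM.realizesSeq_of_finite p hEF O
    let val : (Fin n → O) → ∀ s, (Fin n × I s) ⊕ P s → M.Carrier s := fun i =>
      join (fun s z => b (i z.1) s z.2) p
    have hobs : ∀ i, ∃ c : Option (Formula L (fun s => (Fin n × I s) ⊕ P s)),
        (c = none → θ.Realize M (val i)) ∧
          ∀ ρ, c = some ρ → IsObstruction T θ ρ ∧ ρ.Realize M (val i) := by
      intro i
      by_cases h : θ.Realize M (val i)
      · exact ⟨none, fun _ => h, nofun⟩
      · obtain ⟨ρ, h₁, h₂⟩ := hM.pc.exists_obstruction θ _ h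
        exact ⟨some ρ, nofun, fun ρ' h' => Option.some.inj h' ▸ ⟨h₁, h₂⟩⟩
    choose c hc using hobs
    obtain ⟨f, hf, hom⟩ := hO c
    let g : ℕ → O := fun m => f ⟨m⟩
    have hg : StrictMono g := fun m m' h => hf h
    have hup : ∀ i : Fin n → ℕ, StrictMono i → c (g ∘ i) = c (g ∘ fun j : Fin n => (j : ℕ)) :=
      fun i hi => hom (fun j => ⟨i j⟩) (fun j => ⟨j⟩) (fun _ _ h => hi h) (fun _ _ h => h)
    rcases h₀ : c (g ∘ fun j : Fin n => (j : ℕ)) with _ | ρ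
    · exact .inl (hadd ⟨n, θ⟩ _ (hb.comp hg) fun i hi => (hc (g ∘ i)).1 ((hup i hi).trans h₀))
    · refine .inr ⟨ρ, ((hc _).2 ρ h₀).1, hadd ⟨n, ρ⟩ _ (hb.comp hg) fun i hi => ?_⟩
      exact ((hc (g ∘ i)).2 ρ ((hup i hi).trans h₀)).2
  obtain ⟨b', hb'⟩ := hM.realizesSeq_of_finite p hEF (ULift.{u} ℕ)
  have hb : RealizesSeq p E fun m => b' ⟨m⟩ :=
    hb'.comp (f := ULift.up) fun m m' h => h
  refine ⟨fun m => b' ⟨m⟩, fun n i j hi hj => hM.pc.typeEq_of_imp fun θ hθ => ?_,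
    fun n θ hθ i hi => hb ⟨n, θ⟩ (hBE hθ) i hi⟩
  rcases hcompl n θ with h | ⟨ρ, hρ, h⟩
  · exact hb _ h j hj
  · exact absurd ⟨_, hθ, hb _ h i hi⟩ (hρ M hM.pc.1)

end Indiscernibles

/-! ### Dividing is witnessed by formulas -/

section Dividing

variable {T : Theory L} {M : Structure.{u, u + 1} L}

/-- `ψ(y₁, …, y_k)` is an obstruction of `∃ x (φ(x, y₁) ∧ … ∧ φ(x, y_k))`. -/
def Obstructs (T : Theory L) (k : ℕ) {Γ Δ : List L.Srt}
    (φ : Formula L (fun s => Var Γ s ⊕ Var Δ s)) (ψ : Formula L (fun s => Fin k × Var Δ s)) :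
    Prop :=
  ∀ N : Structure.{u, u + 1} L, IsModel T N →
    ¬ ∃ y : Fin k → ∀ s, Var Δ s → N.Carrier s,
      (∃ x : ∀ s, Var Γ s → N.Carrier s, ∀ j, φ.Realize N (join x (y j))) ∧
        ψ.Realize N (fun s z => y z.1 s z.2)

/-- There is a sequence of realizations of `tp(d/C)` all of whose increasing `k`-tuples
satisfy `ψ`. -/
def SpreadBy (M : Structure.{u, u + 1} L) (C : Elems M) {k : ℕ} {Δ : List L.Srt}
    (ψ : Formula L (fun s => Fin k × Var Δ s)) (d : ∀ s, Var Δ s → M.Carrier s) : Prop :=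
  ∃ d' : ℕ → ∀ s, Var Δ s → M.Carrier s, (∀ i, SameType M C d (d' i)) ∧
    ∀ i : Fin k → ℕ, StrictMono i → ψ.Realize M (concat d' i)

theorem SpreadBy.mono {C C' : Elems M} (h : C' ≤ C) {k : ℕ} {Δ : List L.Srt}
    {ψ : Formula L (fun s => Fin k × Var Δ s)} {d : ∀ s, Var Δ s → M.Carrier s}
    (hd : SpreadBy M C ψ d) : SpreadBy M C' ψ d :=
  let ⟨d', h₁, h₂⟩ := hd
  ⟨d', fun i => (h₁ i).mono h, h₂⟩

/-- A formula `φ(e, d)` with `e` in `A` and `d` in `B ∪ C` that makes `A` dividing dependent on `B`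
over `C`. -/
structure DivWitness (T : Theory L) (M : Structure.{u, u + 1} L) (A C B : Elems M) where
  /-- the size of the inconsistent subfamilies -/
  k : ℕ
  /-- the sorts of `x` -/
  Γ : List L.Srt
  /-- the sorts of `y` -/
  Δ : List L.Srt
  /-- the formula that divides -/
  φ : Formula L (fun s => Var Γ s ⊕ Var Δ s)
  /-- the obstruction that witnesses inconsistency -/
  ψ : Formula L (fun s => Fin k × Var Δ s)
  /-- a tuple in `A` -/
  e : ∀ s, Var Γ s → A s
  /-- a tuple in `B ∪ C` -/
  d : ∀ s, Var Δ s → M.Carrier s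
  two_le : 2 ≤ k
  obstructs : Obstructs T k φ ψ
  mem : ∀ s i, d s i ∈ B s ∨ d s i ∈ C s
  realize : φ.Realize M (join (fun s i => (e s i).1) d)
  spread : SpreadBy M C ψ d

/-- Finite character of dividing: by compactness finitely many formulas are responsible for the
inconsistency, and by indiscernibility one obstruction holds at all increasing tuples. -/
theorem IsMonster.exists_divWitness (hM : IsMonster T M) {A B C : Elems M} (hA : A.IsSmall)
    (hB : B.IsSmall) (hC : C.IsSmall) (h : ¬ DivIndep M A C B) :
    Nonempty (DivWitness T M A C B) := by
  have : Small.{u} (Σ s, A s) := hA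
  have : Small.{u} (Σ s, B s) := hB
  have : Small.{u} (Σ s, C s) := hC
  obtain ⟨b, hind, hsame, hinc⟩ := not_not.1 h
  let ρ : ℕ → Formula L (fun s => (A s ⊕ B s) ⊕ C s) →
      Formula L (fun s => A s ⊕ ((ℕ × B s) ⊕ C s)) := fun i =>
    PForm.relabel fun s => Sum.elim (Sum.map id fun x => .inl (i, x)) (.inr ∘ .inr)
  let p : ∀ s, (ℕ × B s) ⊕ C s → M.Carrier s := join (fun s z => b z.1 s z.2) C.tuple
  have hρ : ∀ i φ (a : ∀ s, A s → M.Carrier s), (ρ i φ).Realize M (join a p) ↔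
      φ.Realize M (join (join a (b i)) C.tuple) := by
    intro i φ a
    refine (realize_relabel M _ _ _).trans (iff_of_eq (congrArg _ ?_))
    funext s x
    rcases x with (x | x) | x <;> rfl
  -- by compactness, the inconsistency involves finitely many formulas and indices
  obtain ⟨S, hS, hfin, hSinc⟩ : ∃ S ⊆ {x : ℕ × _ | x.2 ∈ tp M C A.tuple B.tuple}, S.Finite ∧
      ¬ ∃ a : ∀ s, A s → M.Carrier s, ∀ x ∈ S, x.2.Realize M (join (join a (b x.1)) C.tuple) := by
    by_contra! hcon
    refine hinc ?_
    obtain ⟨a, ha⟩ := hM.compactness p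
      ((fun x => ρ x.1 x.2) '' {x : ℕ × _ | x.2 ∈ tp M C A.tuple B.tuple}) (by
      intro Φ₁ h₁ hfin
      obtain ⟨S, hS, hfinS, rfl⟩ :=
        Set.exists_subset_image_finite_and (p := (· = Φ₁)).1 ⟨Φ₁, h₁, hfin, rfl⟩
      obtain ⟨a, ha⟩ := hcon S hS hfinS
      refine ⟨a, ?_⟩
      rintro _ ⟨x, hx, rfl⟩
      exact (hρ _ _ _).2 (ha x hx))
    exact ⟨a, fun i φ hφ => (hρ i φ a).1 (ha _ ⟨(i, φ), hφ, rfl⟩)⟩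
  obtain ⟨m, hm⟩ := (hfin.image Prod.fst).bddAbove
  let k := m + 2
  let θ := conj (hfin.toFinset.toList.map Prod.snd)
  have hθ : ∀ c, θ.Realize M c ↔ ∀ x ∈ S, x.2.Realize M c := by
    intro c
    rw [realize_conj]
    simp only [List.forall_mem_map, Finset.mem_toList, Set.Finite.mem_toFinset]
  have hθtp : θ ∈ tp M C A.tuple B.tuple := (hθ _).2 fun x hx => hS hx
  have hθinc : ¬ ∃ a : ∀ s, A s → M.Carrier s,
      ∀ i : Fin k, θ.Realize M (join (join a (b i)) C.tuple) := by
    rintro ⟨a, ha⟩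
    refine hSinc ⟨a, fun x hx => (hθ _).1 (ha ⟨x.1, ?_⟩) x hx⟩
    have := hm ⟨x, hx, rfl⟩
    omega
  obtain ⟨Γ, Δ, e, d, φ, he, hφ⟩ := exists_finite_tuples.{u, u + 1, u + 1, u + 1}
    (V := fun s => A s) (W := fun s => B s ⊕ C s)
    (PForm.relabel (fun s => (Equiv.sumAssoc (A s) (B s) (C s))) θ)
  have hφ' : ∀ (a : ∀ s, A s → M.Carrier s) (y : ∀ s, B s → M.Carrier s),
      θ.Realize M (join (join a y) C.tuple) ↔
        φ.Realize M (join (fun s x => a s (e s x)) fun s x => join y C.tuple s (d s x)) := by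
    intro a y
    rw [← hφ, realize_relabel]
    refine iff_of_eq (congrArg _ ?_)
    funext s x
    rcases x with (x | x) | x <;> rfl
  -- `∃ x (φ(x, y₁) ∧ … ∧ φ(x, y_k))` fails along the sequence, hence has an obstruction there
  let χ : Formula L (fun s => Fin k × Var Δ s) := exTuple (conj (List.ofFn fun j : Fin k =>
    PForm.relabel (fun s => Sum.map id fun x => (j, x)) φ))
  have hχ : ∀ (N : Structure.{u, u + 1} L) (y : ∀ s, Fin k × Var Δ s → N.Carrier s),
      χ.Realize N y ↔ ∃ x, ∀ j, φ.Realize N (join x fun s z => y s (j, z)) := by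
    intro N y
    rw [realize_exTuple]
    refine exists_congr fun x => ?_
    rw [realize_conj, List.forall_mem_ofFn_iff]
    refine forall_congr' fun j => (realize_relabel N _ _ _).trans (iff_of_eq (congrArg _ ?_))
    funext s z
    rcases z with z | z <;> rfl
  let d' : ℕ → ∀ s, Var Δ s → M.Carrier s := fun i s x => join (b i) C.tuple s (d s x)
  have hχfalse : ¬ χ.Realize M (concat d' fun j : Fin k => (j : ℕ)) := by
    rw [hχ]
    rintro ⟨x, hx⟩
    -- sorts may be empty, so outside the variables of `φ` the tuple `x` is completed by `A` itself
    refine hθinc ⟨fun s => Function.extend (e s) (x s) (A.tuple s), fun i => ?_⟩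
    rw [hφ']
    simp only [(he _).extend_apply]
    exact hx i
  obtain ⟨ψ, hψ, hψr⟩ := hM.pc.exists_obstruction χ _ hχfalse
  refine ⟨⟨k, Γ, Δ, φ, ψ, e, fun s x => join B.tuple C.tuple s (d s x), by omega, ?_, ?_, ?_,
    d', fun i => ?_, fun i hi => ?_⟩⟩
  · rintro N hN ⟨y, hx, hy⟩
    exact hψ N hN ⟨fun s z => y z.1 s z.2, (hχ N _).2 hx, hy⟩
  · intro s i
    rcases d s i with x | x
    · exact .inl x.2
    · exact .inr x.2
  · exact (hφ' _ _).1 hθtp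
  · exact TypeEq.comp (TypeEq.symm (hsame i)) (fun s => Sum.elim (d s) .inr)
      (by rintro s (x | x) <;> rfl) (by rintro s (x | x) <;> rfl)
  · have := hind k (fun j => j) i (fun _ _ h => h) hi
    refine (TypeEq.comp this (fun s z => (d s z.2).map (fun x => (z.1, x)) id) ?_ ?_ ψ).1 hψr
    all_goals
      rintro s ⟨j, z⟩
      simp only [concat, d']
      rcases d s z with x | x <;> rfl

/-- A dividing formula makes the whole type over `B` divide. The witnessing sequence consists of
images of `d` under automorphisms that fix `C`; the images of an enumeration of `B` under
the same automorphisms are turned into an indiscernible sequence. -/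
theorem DivWitness.not_divIndep (hM : IsMonster T M) {A B C : Elems M}
    (hB : B.IsSmall) (hC : C.IsSmall) (D : DivWitness T M A C B) : ¬ DivIndep M A C B := by
  have : Small.{u} (Σ s, B s) := hB
  have : Small.{u} (Σ s, C s) := hC
  obtain ⟨k, Γ, Δ, φ, ψ, e, d, hk, hobs, hmem, hφ, d', hsame, hψ⟩ := D
  choose f hfd hfC using fun i => hM.exists_auto_over hC (hsame i)
  obtain ⟨J, ⟨E⟩⟩ := exists_equiv_family fun s => B s
  obtain ⟨P, ⟨F⟩⟩ := exists_equiv_family fun s => C s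
  let p : ∀ s, P s → M.Carrier s := fun s x => ((F s).symm x).1
  -- images of an enumeration of `B` under the automorphisms that send `d` to `d' i`
  let B' : ℕ → ∀ s, J s → M.Carrier s := fun i s x => (f i).map s ((E s).symm x).1
  obtain ⟨b, hind, hb⟩ := hM.exists_indiscernible p B'
  have hd : ∀ s i, ∃ z : J s ⊕ P s,
      join (fun s x => ((E s).symm x).1) p s z = d s i := by
    intro s i
    rcases hmem s i with h | h
    · exact ⟨.inl (E s ⟨_, h⟩), by simp [join]⟩
    · exact ⟨.inr (F s ⟨_, h⟩), by simp [join, p]⟩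
  choose g hg using hd
  let b' : ℕ → ∀ s, B s → M.Carrier s := fun i s x => b i s (E s x)
  have hsameb : ∀ i, SameType M C B.tuple (b' i) := by
    intro i
    refine hM.pc.typeEq_of_imp fun θ hθ => ?_
    have key : ∀ (y : ℕ → ∀ s, J s → M.Carrier s) (i : Fin 1 → ℕ),
        Formula.Realize (PForm.relabel (fun s => Sum.map (fun x => ((0 : Fin 1), E s x)) (F s)) θ)
          M (join (concat y i) p) ↔
        θ.Realize M (join (fun s x => y (i 0) s (E s x)) C.tuple) := by
      intro y i
      refine (realize_relabel M _ _ _).trans (iff_of_eq (congrArg _ ?_))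
      funext s x
      rcases x with x | x <;> simp [join, concat, p, Elems.tuple]
    refine (key b fun _ => i).1 (hb 1 _ (fun i _ => (key B' i).2 ?_) _ (Subsingleton.strictMono _))
    have := (sameType_of_auto (f (i 0)) (hfC (i 0)) B.tuple θ).1 hθ
    simpa [B', Elems.tuple] using this
  refine not_not.2 ⟨b', fun n i j hi hj => ?_, fun i => TypeEq.symm (hsameb i), ?_⟩
  · refine (hind n i j hi hj).comp (fun s => Sum.map (Prod.map id (E s)) (F s)) ?_ ?_
    all_goals rintro s (x | x) <;> simp [join, concat, p, b', Elems.tuple]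
  · rintro ⟨a, ha⟩
    let G : ∀ s, Fin k × Var Δ s → (Fin k × J s) ⊕ P s := fun s z =>
      (g s z.2).map (fun x => (z.1, x)) id
    have hG : ∀ (y : ℕ → ∀ s, J s → M.Carrier s) (i : Fin k → ℕ),
        Formula.Realize (PForm.relabel G ψ) M (join (concat y i) p) ↔
        ψ.Realize M (fun s z => join (y (i z.1)) p s (g s z.2)) := by
      intro y i
      refine (realize_relabel M _ _ _).trans (iff_of_eq (congrArg _ ?_))
      funext s z
      simp only [G]
      rcases g s z.2 with x | x <;> rfl
    have hψb := (hG b fun j => j).1 (hb k _ (fun i hi => (hG B' i).2 ?_) _ fun _ _ h => h)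
    · refine hobs M hM.pc.1 ⟨fun j s z => join (b j) p s (g s z),
        ⟨fun s x => a s (e s x), fun j => ?_⟩, hψb⟩
      let R : ∀ s, Var Γ s ⊕ Var Δ s → (A s ⊕ B s) ⊕ C s := fun s =>
        Sum.elim (fun x => .inl (.inl (e s x)))
          fun z => (g s z).elim (fun x => .inl (.inr ((E s).symm x))) fun x => .inr ((F s).symm x)
      have hR := ha j (PForm.relabel R φ) ((realize_relabel M _ _ _).2 ?_)
      · refine (iff_of_eq (congrArg _ ?_)).1 ((realize_relabel M _ _ _).1 hR)
        funext s z
        rcases z with z | z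
        · rfl
        · simp only [R, join, Sum.elim_inr]
          rcases g s z with x | x <;> simp [b', p, Elems.tuple]
      · refine (iff_of_eq (congrArg _ ?_)).1 hφ
        funext s z
        rcases z with z | z
        · rfl
        · simp only [R, join, Sum.elim_inr, ← hg]
          rcases g s z with x | x <;> rfl
    · refine (iff_of_eq (congrArg _ ?_)).1 (hψ i hi)
      funext s z
      rw [concat, ← hfd, ← hg]
      rcases g s z.2 with x | x
      · rfl
      · exact hfC _ _ _ ((F s).symm x).2

end Dividing

/-! ### From a dividing chain to the tree property -/

section Tree

variable {T : Theory L} {M : Structure.{u, u + 1} L}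

theorem Elems.isSmall_of_forall_exists {C : Elems M} {I : L.Srt → Type v} [Small.{u} (Σ s, I s)]
    (p : ∀ s, I s → M.Carrier s) (h : ∀ s, ∀ m ∈ C s, ∃ i, p s i = m) : C.IsSmall := by
  choose g hg using h
  refine small_of_injective (β := Σ s, I s) (f := fun x => ⟨x.1, g x.1 x.2.1 x.2.2⟩) ?_
  rintro ⟨s, m, hm⟩ ⟨t, n, hn⟩ h
  obtain ⟨rfl, h⟩ := Sigma.mk.inj_iff.1 h
  have h' := congrArg (p s) (eq_of_heq h)
  rw [hg, hg] at h'
  cases h'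
  rfl

/-- The automorphism attached to a node of the tree at height `n`: the composite of
the automorphisms along the path to the node. -/
def pathMap (h : ℕ → ℕ → Auto M) : ℕ → List ℕ → ∀ s, M.Carrier s → M.Carrier s
  | _, [], _, m => m
  | n, i :: η, s, m => (h n i).map s (pathMap h (n + 1) η s m)

theorem pathMap_append (h : ℕ → ℕ → Auto M) (i : ℕ) {s : L.Srt} (m : M.Carrier s) :
    ∀ (η : List ℕ) (n : ℕ),
      pathMap h n (η ++ [i]) s m = pathMap h n η s ((h (n + η.length) i).map s m)
  | [], n => rfl
  | j :: η, n => by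
    simp only [List.cons_append, pathMap, pathMap_append h i m η (n + 1), List.length_cons]
    rw [show n + 1 + η.length = n + (η.length + 1) by omega]

theorem typeEq_pathMap (h : ℕ → ℕ → Auto M) {V : L.Srt → Type v} (a : ∀ s, V s → M.Carrier s) :
    ∀ (η : List ℕ) (n : ℕ), TypeEq M a (fun s x => pathMap h n η s (a s x))
  | [], _ => fun _ => Iff.rfl
  | i :: η, n => (typeEq_pathMap h a η (n + 1)).trans ((h n i).typeEq _)

/-- If `φ(x, d₀), φ(x, d₁), …` are jointly satisfied and each `φ(x, dₙ)` divides over the earlier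
parameters with respect to the same obstruction `ψ`, then `φ` has the tree property: the tree is
obtained by moving the sequence by automorphisms. -/
theorem IsMonster.hasTreeProperty_of_seq (hM : IsMonster T M) {k : ℕ} {Γ Δ : List L.Srt}
    {φ : Formula L (fun s => Var Γ s ⊕ Var Δ s)} {ψ : Formula L (fun s => Fin k × Var Δ s)}
    (hobs : Obstructs T k φ ψ) (x : ∀ s, Var Γ s → M.Carrier s)
    (d : ℕ → ∀ s, Var Δ s → M.Carrier s) (hφ : ∀ n, φ.Realize M (join x (d n)))
    (hd : ∀ n, SpreadBy M (fun s => {m | ∃ j < n, ∃ i, d j s i = m}) ψ (d n)) :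
    HasTreeProperty T M k φ := by
  choose d' hsame hψ using hd
  have hsmall : ∀ n, Elems.IsSmall (M := M) (fun s => {m | ∃ j < n, ∃ i, d j s i = m}) :=
    fun n => Elems.isSmall_of_forall_exists (I := fun s => ℕ × Var Δ s) (fun s z => d z.1 s z.2) (by
      rintro s m ⟨j, -, i, rfl⟩
      exact ⟨(j, i), rfl⟩)
  choose h hh hfix using fun n i => hM.exists_auto_over (hsmall n) (hsame n i)
  let c : List ℕ → ∀ s, Var Δ s → M.Carrier s := fun η s i => pathMap h 1 η s (d η.length s i)
  have hc : ∀ (σ : ℕ → ℕ) (n m : ℕ), m ≤ n → ∀ s i,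
      c ((List.range m).map σ) s i = pathMap h 1 ((List.range n).map σ) s (d m s i) := by
    intro σ n m hmn s i
    induction hmn with
    | refl => simp [c]
    | @step n hmn ih =>
      rw [ih, List.range_succ, List.map_append]
      refine Eq.trans ?_ (pathMap_append h (σ n) _ _ _).symm
      have hlt : m < 1 + n := by
        have := Nat.le_of_succ_le_succ (Nat.succ_le_succ hmn)
        omega
      rw [List.length_map, List.length_range, hfix _ _ _ _ ⟨m, hlt, i, rfl⟩]
  refine ⟨ψ, c, hobs, fun σ => ?_, fun η i hi => ?_⟩
  · let p : ∀ s, ℕ × Var Δ s → M.Carrier s := fun s z => c ((List.range z.1).map σ) s z.2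
    let ρ : ℕ → Formula L (fun s => Var Γ s ⊕ (ℕ × Var Δ s)) := fun n =>
      PForm.relabel (fun s => Sum.map id fun i => (n, i)) φ
    have hρ : ∀ n (y : ∀ s, Var Γ s → M.Carrier s), (ρ n).Realize M (join y p) ↔
        φ.Realize M (join y (c ((List.range n).map σ))) := by
      intro n y
      refine (realize_relabel M _ _ _).trans (iff_of_eq (congrArg _ ?_))
      funext s z
      rcases z with z | z <;> rfl
    obtain ⟨y, hy⟩ := hM.compactness p (Set.range ρ) (by
      intro Φ₁ h₁ hfin
      rw [← Set.image_univ] at h₁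
      obtain ⟨S, -, hS, rfl⟩ :=
        Set.exists_subset_image_finite_and (p := (· = Φ₁)).1 ⟨Φ₁, h₁, hfin, rfl⟩
      obtain ⟨n, hn⟩ := hS.bddAbove
      refine ⟨fun s i => pathMap h 1 ((List.range n).map σ) s (x s i), ?_⟩
      rintro _ ⟨m, hm, rfl⟩
      rw [hρ]
      refine (iff_of_eq (congrArg _ ?_)).1
        ((typeEq_pathMap h (join x (d m)) ((List.range n).map σ) 1 φ).1 (hφ m))
      funext s z
      rcases z with z | z
      · rfl
      · exact (hc σ n m (hn hm) s z).symm)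
    exact ⟨y, fun n => (hρ n y).1 (hy _ ⟨n, rfl⟩)⟩
  · refine (iff_of_eq (congrArg _ ?_)).1
      ((typeEq_pathMap h _ η 1 ψ).1 (hψ (1 + η.length) i hi))
    funext s z
    simp only [concat, c, pathMap_append, List.length_append, List.length_singleton, ← hh]
    rw [Nat.add_comm 1]

end Tree

/-! ### Counting formulas -/

section Counting

variable {T : Theory L} {M : Structure.{u, u + 1} L}

/-- Equivalence modulo `T` of formulas in an arbitrary family of variables. -/
def formulaSetoid (T : Theory L) (V : L.Srt → Type v) : Setoid (Formula L V) where
  r φ ψ := ∀ N : Structure.{u, u + 1} L, IsModel T N →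
    ∀ a : ∀ s, V s → N.Carrier s, φ.Realize N a ↔ ψ.Realize N a
  iseqv := ⟨fun _ _ _ _ => Iff.rfl, fun h N hN a => (h N hN a).symm,
    fun h h' N hN a => (h N hN a).trans (h' N hN a)⟩

theorem mk_quotient_formulaSetoid_le (V : L.Srt → Type u) [Finite (Σ s, V s)] :
    Cardinal.mk (Quotient (formulaSetoid T V)) ≤ T.card := by
  obtain ⟨Γ, ⟨E⟩⟩ := exists_var_equiv V
  refine Cardinal.mk_le_of_injective (f := fun q => ⟨Γ, q.map'
    (PForm.relabel fun s => (E s).symm) fun φ ψ h N hN a => ?_⟩) ?_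
  · rw [realize_relabel, realize_relabel]
    exact h N hN _
  · intro q q' h
    have h := eq_of_heq (Sigma.mk.inj_iff.1 h).2
    induction q, q' using Quotient.inductionOn₂ with
    | h φ ψ =>
    refine Quotient.sound fun N hN a => ?_
    have := Quotient.exact h N hN fun s x => a s (E s x)
    rw [realize_relabel, realize_relabel] at this
    simpa using this

theorem mk_list_sort_le : Cardinal.mk (List L.Srt) ≤ T.card :=
  Cardinal.mk_le_of_injective (f := fun Γ => ⟨Γ, Quotient.mk _ .top⟩) fun _ _ h =>
    (Sigma.mk.inj_iff.1 h).1

theorem aleph0_le_card [Nonempty L.Srt] : Cardinal.aleph0 ≤ T.card :=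
  (Cardinal.aleph0_le_mk (List L.Srt)).trans mk_list_sort_le

theorem mk_sigma_le {ι : Type u} {F : ι → Type u} {ν : Cardinal.{u}} (hν : Cardinal.aleph0 ≤ ν)
    (hι : Cardinal.mk ι ≤ ν) (hF : ∀ i, Cardinal.mk (F i) ≤ ν) : Cardinal.mk (Σ i, F i) ≤ ν := by
  rw [Cardinal.mk_sigma]
  refine (Cardinal.sum_le_sum _ (fun _ => ν) hF).trans ?_
  rw [Cardinal.sum_const']
  exact Cardinal.mul_le_of_le hν hι le_rfl

theorem mk_prod_le {α β : Type u} {ν : Cardinal.{u}} (hν : Cardinal.aleph0 ≤ ν)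
    (hα : Cardinal.mk α ≤ ν) (hβ : Cardinal.mk β ≤ ν) : Cardinal.mk (α × β) ≤ ν := by
  rw [Cardinal.mk_prod, Cardinal.lift_id, Cardinal.lift_id]
  exact Cardinal.mul_le_of_le hν hα hβ

theorem mk_tuple_le {S : Type u} (Γ : List S) (X : S → Type u) {ν : Cardinal.{u}}
    (hν : Cardinal.aleph0 ≤ ν) (hX : Cardinal.mk (Σ s, X s) ≤ ν) :
    Cardinal.mk (∀ s, Var Γ s → X s) ≤ ν := by
  have h : Cardinal.mk (∀ s, Var Γ s → X s) ≤ Cardinal.mk ((Σ s, Var Γ s) → Σ s, X s) := by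
    refine Cardinal.mk_le_of_injective (f := fun e z => ⟨z.1, e z.1 z.2⟩) fun e e' h => ?_
    funext s i
    exact eq_of_heq (Sigma.mk.inj_iff.1 (congrFun h ⟨s, i⟩)).2
  obtain ⟨n, hn⟩ := Cardinal.lt_aleph0.1 (Cardinal.lt_aleph0_of_finite (Σ s, Var Γ s))
  refine h.trans ?_
  rw [← Cardinal.power_def, hn]
  exact (Cardinal.power_le_power_right hX).trans (Cardinal.power_nat_le hν)

/-- The part of a `DivWitness` that can be prescribed, with formulas up to equivalence. -/
abbrev Colour (T : Theory L) (X : L.Srt → Type u) : Type u :=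
  Σ Γ Δ : List L.Srt, (∀ s, Var Γ s → X s) × Quotient (formulaSetoid T fun s => Var Γ s ⊕ Var Δ s) ×
    Σ k : ULift.{u} ℕ, Quotient (formulaSetoid T fun s => Fin k.down × Var Δ s)

theorem mk_colour_le {X : L.Srt → Type u} {ν : Cardinal.{u}} (hν : Cardinal.aleph0 ≤ ν)
    (hT : T.card ≤ ν) (hX : Cardinal.mk (Σ s, X s) ≤ ν) : Cardinal.mk (Colour T X) ≤ ν := by
  refine mk_sigma_le hν (mk_list_sort_le.trans hT) fun Γ =>
    mk_sigma_le hν (mk_list_sort_le.trans hT) fun Δ =>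
    mk_prod_le hν (mk_tuple_le Γ X hν hX) (mk_prod_le hν ?_ (mk_sigma_le hν (by simpa) fun k => ?_))
  · have : Finite (Σ s, Var Γ s ⊕ Var Δ s) :=
      Finite.of_equiv _ (Equiv.sigmaSumDistrib (Var Γ) (Var Δ)).symm
    exact (mk_quotient_formulaSetoid_le _).trans hT
  · have : Finite (Σ s, Fin k.down × Var Δ s) := by
      refine Finite.of_surjective (α := Fin k.down × Σ s, Var Δ s)
        (fun z => ⟨z.2.1, z.1, z.2.2⟩) ?_
      rintro ⟨s, j, i⟩
      exact ⟨(j, ⟨s, i⟩), rfl⟩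
    exact (mk_quotient_formulaSetoid_le _).trans hT

theorem Elems.isSmall_of_card_le {A : Elems M} {ν : Cardinal.{u}}
    (h : A.card ≤ Cardinal.lift.{u + 1} ν) : A.IsSmall := by
  induction ν using Cardinal.inductionOn with
  | mk α =>
  rw [← Cardinal.mk_uLift] at h
  obtain ⟨f⟩ := h
  exact small_of_injective f.injective

theorem isSmall_below {μ : Ordinal.{u}} {b : Set.Iio μ → Elems M} (hb : ∀ i, (b i).IsSmall)
    (i : Ordinal.{u}) : (below μ b i).IsSmall := by
  have : ∀ j, Small.{u} (Σ s, b j s) := hb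
  refine small_of_surjective (α := Σ j : {j : Set.Iio μ // j.1 < i}, Σ s, b j.1 s)
    (f := fun z => ⟨z.2.1, z.2.2.1, z.1.1, z.1.2, z.2.2.2⟩) ?_
  rintro ⟨s, m, j, hj, hm⟩
  exact ⟨⟨⟨j, hj⟩, s, m, hm⟩, rfl⟩

theorem isSmall_above {μ : Ordinal.{u}} {b : Set.Iio μ → Elems M} (hb : ∀ i, (b i).IsSmall)
    (i : Ordinal.{u}) : (above μ b i).IsSmall := by
  have : ∀ j, Small.{u} (Σ s, b j s) := hb
  refine small_of_surjective (α := Σ j : {j : Set.Iio μ // i ≤ j.1}, Σ s, b j.1 s)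
    (f := fun z => ⟨z.2.1, z.2.2.1, z.1.1, z.1.2, z.2.2.2⟩) ?_
  rintro ⟨s, m, j, hj, hm⟩
  exact ⟨⟨⟨j, hj⟩, s, m, hm⟩, rfl⟩

/-- In an NTP theory, a set `A` of cardinality at most `ν ≥ |T|` is independent from some final
segment of a given sequence of length `ν⁺` over the corresponding initial segment. Otherwise, since
there are at most `ν` formulas, the same formula divides at an unbounded set of places. -/
theorem IsMonster.exists_divIndep_above (hM : IsMonster T M) (hN : NTP T M) {ν : Cardinal.{u}}
    (hν : Cardinal.aleph0 ≤ ν) (hT : T.card ≤ ν) {A : Elems M}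
    (hA : A.card ≤ Cardinal.lift.{u + 1} ν) (μ : Ordinal.{u}) (b : Set.Iio μ → Elems M)
    (hμ : μ ≤ (Order.succ ν).ord) (hb : ∀ i, (b i).IsSmall) :
    ∃ i₀ < (Order.succ ν).ord, DivIndep M A (below μ b i₀) (above μ b i₀) := by
  by_contra! hcon
  have hAs : Small.{u} (Σ s, A s) := Elems.isSmall_of_card_le hA
  obtain ⟨X, ⟨E⟩⟩ := exists_equiv_family fun s => A s
  have hX : Cardinal.mk (Σ s, X s) ≤ ν := by
    rw [← Cardinal.lift_le.{u + 1}]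
    refine le_trans (le_of_eq ?_) hA
    rw [Elems.card, ← Cardinal.lift_id'.{u, u + 1} (Cardinal.mk (Σ s, A s))]
    exact Cardinal.lift_mk_eq'.2 ⟨(Equiv.sigmaCongrRight E).symm⟩
  let I := (Order.succ ν).ord.ToType
  let o : I → Ordinal.{u} := fun t => (Ordinal.ToType.mk.symm t).1
  have ho : StrictMono o := fun t t' h => (OrderIso.lt_iff_lt Ordinal.ToType.mk.symm).2 h
  have hcol : ∀ t : I, ∃ c : Colour T X, ∃ d : ∀ s, Var c.2.1 s → M.Carrier s,
      2 ≤ c.2.2.2.2.1.down ∧ Obstructs T c.2.2.2.2.1.down c.2.2.2.1.out c.2.2.2.2.2.out ∧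
      (∀ s i, ∃ j, d s i ∈ b j s) ∧
      c.2.2.2.1.out.Realize M (join (fun s i => ((E s).symm (c.2.2.1 s i)).1) d) ∧
      SpreadBy M (below μ b (o t)) c.2.2.2.2.2.out d := by
    intro t
    obtain ⟨⟨k, Γ, Δ, φ, ψ, e, d, hk, hobs, hmem, hφ, hsp⟩⟩ := hM.exists_divWitness hAs
      (isSmall_above hb _) (isSmall_below hb _) (hcon (o t) (Ordinal.ToType.mk.symm t).2)
    have hφ' := Quotient.mk_out (s := formulaSetoid T fun s => Var Γ s ⊕ Var Δ s) φ
    have hψ' := Quotient.mk_out (s := formulaSetoid T fun s => Fin k × Var Δ s) ψ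
    refine ⟨⟨Γ, Δ, fun s i => E s (e s i), Quotient.mk _ φ, ⟨k⟩, Quotient.mk _ ψ⟩, d, hk,
      ?_, ?_, ?_, ?_⟩
    · rintro N hN ⟨y, ⟨x, hx⟩, hy⟩
      exact hobs N hN ⟨y, ⟨x, fun j => (hφ' N hN _).1 (hx j)⟩, (hψ' N hN _).1 hy⟩
    · intro s i
      rcases hmem s i with ⟨j, -, h⟩ | ⟨j, -, h⟩ <;> exact ⟨j, h⟩
    · simp only [Equiv.symm_apply_apply]
      exact (hφ' M hM.pc.1 _).2 hφ
    · obtain ⟨d', h₁, h₂⟩ := hsp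
      exact ⟨d', h₁, fun i hi => (hψ' M hM.pc.1 _).2 (h₂ i hi)⟩
  choose col hcol using hcol
  have hreg := Cardinal.isRegular_succ hν
  obtain ⟨c, hc⟩ := Cardinal.infinite_pigeonhole_card col (Order.succ ν)
    (Cardinal.mk_ord_toType _).ge hreg.aleph0_le
    (by rw [hreg.cof_ord]; exact Order.lt_succ_of_le (mk_colour_le hν hT hX))
  have hIio : ∀ t : I, Cardinal.mk (Set.Iio t) < Order.succ ν := fun t => 
    (Cardinal.mk_Iio_lt t (by rw [Cardinal.mk_ord_toType, Ordinal.type_toType])).trans_eq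
      (Cardinal.mk_ord_toType _)
  have hunb : ∀ t : I, ∃ t' : I, t < t' ∧ col t' = c := by
    intro t
    by_contra! h
    have hsub : col ⁻¹' {c} ⊆ insert t (Set.Iio t) := fun t' ht' => by
      rw [Set.Iio_insert]
      exact not_lt.1 fun hlt => h t' hlt ht'
    refine (hc.trans (Cardinal.mk_le_mk_of_subset hsub)).not_gt
      ((Cardinal.mk_insert_le).trans_lt ?_)
    exact Cardinal.add_lt_of_lt hreg.aleph0_le (hIio t)
      (Cardinal.one_lt_aleph0.trans_le hreg.aleph0_le)
  obtain ⟨Γ, Δ, e, qφ, k, qψ⟩ := c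
  have hS : ∀ t : {t : I // col t = ⟨Γ, Δ, e, qφ, k, qψ⟩}, ∃ d : ∀ s, Var Δ s → M.Carrier s,
      2 ≤ k.down ∧ Obstructs T k.down qφ.out qψ.out ∧ (∀ s i, ∃ j, d s i ∈ b j s) ∧
      qφ.out.Realize M (join (fun s i => ((E s).symm (e s i)).1) d) ∧
      SpreadBy M (below μ b (o t)) qψ.out d := by
    rintro ⟨t, ht⟩
    have := hcol t
    rwa [ht] at this
  choose d hk hobs hmem hφ hsp using hS
  have hstep : ∀ t : {t : I // col t = ⟨Γ, Δ, e, qφ, k, qψ⟩},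
      ∃ t' : {t : I // col t = ⟨Γ, Δ, e, qφ, k, qψ⟩}, t < t' ∧
        ∀ s i, d t s i ∈ below μ b (o t') s := by
    intro t
    choose j hj using hmem t
    let j' : (Σ s, Var Δ s) → I := fun z =>
      Ordinal.ToType.mk ⟨(j z.1 z.2).1, (show _ < _ from (j z.1 z.2).2).trans_le hμ⟩
    have : Nonempty I := ⟨t.1⟩
    obtain ⟨t₁, ht₁⟩ := ((Set.finite_range j').insert t.1).bddAbove
    obtain ⟨t', hlt, ht'⟩ := hunb t₁
    refine ⟨⟨t', ht'⟩, (ht₁ (Set.mem_insert _ _)).trans_lt hlt, fun s i => ⟨j s i, ?_, hj s i⟩⟩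
    have := ho ((ht₁ (Set.mem_insert_of_mem _ ⟨⟨s, i⟩, rfl⟩)).trans_lt hlt)
    simpa [o, j'] using this
  choose step hlt hstep using hstep
  -- iterating `step` gives infinitely many places whose parameters lie below the next place
  obtain ⟨t₀, ht₀⟩ : ∃ t : I, col t = ⟨Γ, Δ, e, qφ, k, qψ⟩ := by
    have hpos : (0 : Ordinal) < (Order.succ ν).ord := hreg.ord_pos
    obtain ⟨t, -, ht⟩ := hunb (Ordinal.ToType.mk ⟨0, hpos⟩)
    exact ⟨t, ht⟩
  let seq : ℕ → {t : I // col t = ⟨Γ, Δ, e, qφ, k, qψ⟩} := fun n => step^[n] ⟨t₀, ht₀⟩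
  have hsucc : ∀ n, seq (n + 1) = step (seq n) := fun n => Function.iterate_succ_apply' _ _ _
  have hseq : StrictMono seq := strictMono_nat_of_lt_succ fun n => by
    rw [hsucc]
    exact hlt _
  refine hN ⟨k.down, Γ, Δ, qφ.out, hk ⟨t₀, ht₀⟩, hM.hasTreeProperty_of_seq (hobs ⟨t₀, ht₀⟩)
    (fun s i => ((E s).symm (e s i)).1) (fun n => d (seq n)) (fun n => hφ _) fun n =>
    (hsp (seq n)).mono ?_⟩
  rintro s _ ⟨m, hm, i, rfl⟩
  obtain ⟨j, hj, h⟩ := hstep (seq m) s i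
  rw [← hsucc] at hj
  exact ⟨j, hj.trans_le (ho.monotone (hseq.monotone (Nat.succ_le_of_lt hm))), h⟩

end Counting

/-! ### From sequences to sets -/

section Sequences

variable {T : Theory L} {M : Structure.{u, u + 1} L}

theorem IsMonster.not_divIndep_mono (hM : IsMonster T M) {A B B' C : Elems M} (hA : A.IsSmall)
    (hB' : B'.IsSmall) (hC : C.IsSmall) (hBB' : B ≤ B') (h : ¬ DivIndep M A C B) :
    ¬ DivIndep M A C B' := by
  have : Small.{u} (Σ s, B' s) := hB'
  have hB : B.IsSmall := Elems.isSmall_of_forall_exists B'.tuple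
    fun s m hm => ⟨⟨m, hBB' s hm⟩, rfl⟩
  obtain ⟨D⟩ := hM.exists_divWitness hA hB hC h
  exact DivWitness.not_divIndep hM hB' hC
    { D with mem := fun s i => (D.mem s i).imp_left fun h => hBB' s h }

theorem IsMonster.exists_finite_not_divIndep (hM : IsMonster T M) {A C C' : Elems M}
    (hA : A.IsSmall) (hC : C.IsSmall) (hC' : C' ≤ C) (h : ¬ DivIndep M A C' C) :
    ∃ B ≤ C, Finite (Σ s, B s) ∧ ¬ DivIndep M A C' B := by
  have : Small.{u} (Σ s, C s) := hC
  have hC's : C'.IsSmall := Elems.isSmall_of_forall_exists C.tuple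
    fun s m hm => ⟨⟨m, hC' s hm⟩, rfl⟩
  obtain ⟨D⟩ := hM.exists_divWitness hA hC hC's h
  refine ⟨fun s => Set.range (D.d s), ?_, ?_, ?_⟩
  · rintro s _ ⟨i, rfl⟩
    exact (D.mem s i).elim id fun h => hC' s h
  · refine Finite.of_surjective (α := Σ s, Var D.Δ s) (fun z => ⟨z.1, D.d z.1 z.2, z.2, rfl⟩) ?_
    rintro ⟨s, _, i, rfl⟩
    exact ⟨⟨s, i⟩, rfl⟩
  · exact DivWitness.not_divIndep hM
      (Elems.isSmall_of_forall_exists (I := Var D.Δ) D.d fun s m hm => hm) hC's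
      { D with mem := fun s i => .inl ⟨i, rfl⟩ }

theorem card_below_lt {lam κ : Cardinal.{u}} (hlam : lam ≤ κ) (hκ : Cardinal.aleph0 < κ)
    (b : Set.Iio lam.ord → Elems M) (hb : ∀ i, Finite (Σ s, b i s)) {i : Ordinal.{u}}
    (hi : i < lam.ord) : (below lam.ord b i).card < Cardinal.lift.{u + 1} κ := by
  have h₁ : (below lam.ord b i).card ≤
      Cardinal.mk (Σ j : Set.Iio i, Σ s, b ⟨j.1, j.2.trans hi⟩ s) := by
    refine Cardinal.mk_le_of_surjective (f := fun z =>
      ⟨z.2.1, z.2.2.1, ⟨z.1.1, z.1.2.trans hi⟩, z.1.2, z.2.2.2⟩) ?_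
    rintro ⟨s, m, j, hj, hm⟩
    exact ⟨⟨⟨j.1, hj⟩, s, m, hm⟩, rfl⟩
  refine h₁.trans_lt ?_
  rw [Cardinal.mk_sigma]
  refine (Cardinal.sum_le_sum _ (fun _ => Cardinal.aleph0) fun j =>
    (Cardinal.lt_aleph0_of_finite _).le).trans_lt ?_
  rw [Cardinal.sum_const']
  refine Cardinal.mul_lt_of_lt ?_ ?_ ?_
  · simpa using hκ.le
  · rw [Cardinal.mk_Iio_ordinal, Cardinal.lift_lt]
    exact (Cardinal.lt_ord.1 hi).trans_le hlam
  · simpa using hκ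

/-- If `A` is independent from a final segment of every sequence of length at most `lam`,
over the corresponding initial segment, then `A` is independent from every `C` over a
small subset of `C`: otherwise a sequence of finite subsets of `C` without such a final segment is
constructed by recursion. -/
theorem IsMonster.exists_divIndep_subset (hM : IsMonster T M) {A C : Elems M} (hA : A.IsSmall)
    (hC : C.IsSmall) {lam κ : Cardinal.{u}} (hlam : lam ≤ κ) (hκ : Cardinal.aleph0 < κ)
    (h : ∀ b : Set.Iio lam.ord → Elems M, (∀ i, (b i).IsSmall) →
      ∃ i₀ < lam.ord, DivIndep M A (below lam.ord b i₀) (above lam.ord b i₀)) :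
    ∃ C' ≤ C, C'.card < Cardinal.lift.{u + 1} κ ∧ DivIndep M A C' C := by
  by_contra! hcon
  have hstep : ∀ C' : Elems M, ∃ B ≤ C, Finite (Σ s, B s) ∧
      (C' ≤ C → C'.card < Cardinal.lift.{u + 1} κ → ¬ DivIndep M A C' B) := by
    intro C'
    by_cases hC' : C' ≤ C ∧ C'.card < Cardinal.lift.{u + 1} κ
    · obtain ⟨B, hB, hfin, hdep⟩ :=
        hM.exists_finite_not_divIndep hA hC hC'.1 (hcon C' hC'.1 hC'.2)
      exact ⟨B, hB, hfin, fun _ _ => hdep⟩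
    · exact ⟨fun _ => ∅, fun s => Set.empty_subset _,
        @Finite.of_subsingleton _ ⟨fun x => x.2.2.elim⟩,
        fun h₁ h₂ => absurd ⟨h₁, h₂⟩ hC'⟩
  choose β hβC hβfin hβ using hstep
  let b : Set.Iio lam.ord → Elems M := wellFounded_lt.fix fun i rec =>
    β fun s => {m | ∃ j, ∃ h : j < i, m ∈ rec j h s}
  have hb : ∀ i : Set.Iio lam.ord, b i = β (below lam.ord b i.1) := by
    intro i
    refine (WellFounded.fix_eq _ _ _).trans (congrArg β ?_)
    funext s
    ext m
    exact ⟨fun ⟨j, h, hm⟩ => ⟨j, h, hm⟩, fun ⟨j, h, hm⟩ => ⟨j, h, hm⟩⟩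
  have hbC : ∀ i, b i ≤ C := fun i => hb i ▸ hβC _
  have hbfin : ∀ i, Finite (Σ s, b i s) := fun i => by rw [hb]; exact hβfin _
  have hbs : ∀ i, (b i).IsSmall := fun i => by
    have := hbfin i
    exact (inferInstance : Small.{u} (Σ s, b i s))
  obtain ⟨i, hi, hind⟩ := h b hbs
  have hbelow : below lam.ord b i ≤ C := fun s m ⟨j, _, hm⟩ => hbC j s hm
  have hdep := hβ _ hbelow (card_below_lt hlam hκ b hbfin hi)
  rw [← hb ⟨i, hi⟩] at hdep
  exact hM.not_divIndep_mono hA (isSmall_above hbs i) (isSmall_below hbs i)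
    (fun s m hm => ⟨⟨i, hi⟩, le_rfl, hm⟩) hdep hind

end Sequences

/-! ### From the tree property to failure of local character -/

section LongPath

variable {T : Theory L} {M : Structure.{u, u + 1} L}

/-- A finite subset `S` of a linear order, enumerated increasingly by `e`, with inverse `t`. -/
theorem exists_enumeration {N : Type u} [LinearOrder N] [Nonempty N] {S : Set N} (hS : S.Finite) :
    ∃ (t : N → ℕ) (e : ℕ → N), ∀ α ∈ S, e (t α) = α ∧ ∀ m < t α, e m < α := by
  classical
  let F := hS.toFinset
  let f := F.orderIsoOfFin rfl
  refine ⟨fun α => if h : α ∈ F then (f.symm ⟨α, h⟩).1 else 0,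
    fun m => if h : m < F.card then (f ⟨m, h⟩).1 else Classical.arbitrary N, fun α hα => ?_⟩
  have hα' : α ∈ F := hS.mem_toFinset.2 hα
  simp only [hα', dif_pos, Fin.is_lt, Fin.eta, OrderIso.apply_symm_apply, true_and]
  intro m hm
  have hmF : m < F.card := hm.trans (f.symm ⟨α, hα'⟩).2
  simp only [hmF, dif_pos]
  have : f ⟨m, hmF⟩ < f (f.symm ⟨α, hα'⟩) := f.lt_iff_lt.2 hm
  rw [OrderIso.apply_symm_apply] at this
  exact this

/-- By compactness, the tree `ω^{<ω}` in the tree property may be replaced by a tree of any height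
`N` and any width `Λ`. The parameter at the node `σ|_{≤ α}` is written `c α σ`. -/
theorem IsMonster.exists_wide_tree (hM : IsMonster T M) {k : ℕ} (hk : 2 ≤ k) {Γ Δ : List L.Srt}
    {φ : Formula L (fun s => Var Γ s ⊕ Var Δ s)} {ψ : Formula L (fun s => Fin k × Var Δ s)}
    {c : List ℕ → ∀ s, Var Δ s → M.Carrier s}
    (hφ : ∀ σ : ℕ → ℕ, ∃ x : ∀ s, Var Γ s → M.Carrier s,
      ∀ n : ℕ, φ.Realize M (join x (c ((List.range n).map σ))))
    (hψ : ∀ (η : List ℕ) (i : Fin k → ℕ), StrictMono i →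
      ψ.Realize M (fun s z => c (η ++ [i z.1]) s z.2))
    (N Λ : Type u) [LinearOrder N] [Nonempty N] [LinearOrder Λ] [Nonempty Λ] :
    ∃ c' : N → (N → Λ) → ∀ s, Var Δ s → M.Carrier s,
      (∀ α σ σ', (∀ β ≤ α, σ β = σ' β) → c' α σ = c' α σ') ∧
      (∀ σ, ∃ x : ∀ s, Var Γ s → M.Carrier s, ∀ α, φ.Realize M (join x (c' α σ))) ∧
      ∀ α (σ : Fin k → N → Λ), (∀ i j, ∀ β < α, σ i β = σ j β) → (StrictMono fun j => σ j α) →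
        ψ.Realize M (fun s z => c' α (σ z.1) s z.2) := by
  let tr : N → (N → Λ) → N → Λ := fun α σ β => if β ≤ α then σ β else Classical.arbitrary Λ
  let X : L.Srt → Type u := fun s => ((N × (N → Λ)) × Var Δ s) ⊕ ((N → Λ) × Var Γ s)
  let Y : L.Srt → Type u := fun s => X s ⊕ PEmpty.{u + 1}
  let p : ∀ s, PEmpty.{u + 1} → M.Carrier s := fun s x => x.elim
  let ρ : (N × (N → Λ)) ⊕ (N × (Fin k → N → Λ)) → Formula L Y := Sum.elim
    (fun x => PForm.relabel
      (fun s => Sum.elim (fun i => .inl (.inr (x.2, i)))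
        fun i => .inl (.inl ((x.1, tr x.1 x.2), i))) φ)
    (fun x => PForm.relabel (fun s z => .inl (.inl ((x.1, tr x.1 (x.2 z.1)), z.2))) ψ)
  have hρ₁ : ∀ α σ (y : ∀ s, (N × (N → Λ)) × Var Δ s → M.Carrier s)
      (x : ∀ s, (N → Λ) × Var Γ s → M.Carrier s),
      (ρ (.inl (α, σ))).Realize M (join (join y x) p) ↔
      φ.Realize M (join (fun s i => x s (σ, i)) fun s i => y s ((α, tr α σ), i)) := by
    intro α σ y x
    refine (realize_relabel M _ _ _).trans (iff_of_eq (congrArg _ ?_))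
    funext s z
    rcases z with z | z <;> rfl
  have hρ₂ : ∀ α (σ : Fin k → N → Λ) (y : ∀ s, (N × (N → Λ)) × Var Δ s → M.Carrier s)
      (x : ∀ s, (N → Λ) × Var Γ s → M.Carrier s),
      (ρ (.inr (α, σ))).Realize M (join (join y x) p) ↔
      ψ.Realize M (fun s z => y s ((α, tr α (σ z.1)), z.2)) :=
    fun α σ y x => realize_relabel M _ _ _
  obtain ⟨a, ha⟩ := hM.saturated X (fun _ => PEmpty) p (ρ '' Sum.elim (fun _ => True)
      fun x => (∀ i j, ∀ β < x.1, x.2 i β = x.2 j β) ∧ StrictMono fun j => x.2 j x.1) (by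
    intro Φ₁ h₁ hfin
    obtain ⟨S, hS, hfinS, rfl⟩ :=
      Set.exists_subset_image_finite_and (p := (· = Φ₁)).1 ⟨Φ₁, h₁, hfin, rfl⟩
    -- only finitely many levels and finitely many siblings are relevant
    obtain ⟨t, e, he⟩ := exists_enumeration (hfinS.image (Sum.elim Prod.fst Prod.fst))
    obtain ⟨r, hr⟩ := exists_strictMonoOn (S := ⋃ z ∈ S,
        (Sum.elim (fun _ => ∅) (fun x => Set.range fun j => x.2 j x.1) z : Set Λ))
      (hfinS.biUnion fun z _ => by
        rcases z with z | z
        · exact Set.finite_empty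
        · exact Set.finite_range _)
    choose x hx using fun σ : N → Λ => hφ fun m => r (σ (e m))
    have htr : ∀ α (σ : N → Λ), e (t α) = α → (∀ m < t α, e m < α) →
        ∀ m ≤ t α, tr α σ (e m) = σ (e m) := by
      intro α σ h h' m hm
      refine if_pos ?_
      rcases hm.lt_or_eq with hm | rfl
      · exact (h' m hm).le
      · exact h.le
    refine ⟨join (fun s z => c ((List.range (t z.1.1 + 1)).map fun m => r (z.1.2 (e m))) s z.2)
      fun s z => x z.1 s z.2, ?_⟩
    rintro _ ⟨⟨α, σ⟩ | ⟨α, σ⟩, hz, rfl⟩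
    · obtain ⟨h, h'⟩ := he α ⟨_, hz, rfl⟩
      rw [hρ₁]
      refine (iff_of_eq (congrArg _ ?_)).1 (hx σ (t α + 1))
      congr 1
      funext s i
      refine congrArg (fun l => c l s i) (List.map_congr_left fun m hm => ?_)
      change r _ = r (tr α σ (e m))
      rw [htr α σ h h' m (Nat.lt_succ_iff.1 (List.mem_range.1 hm))]
    · obtain ⟨h, h'⟩ := he α ⟨_, hz, rfl⟩
      obtain ⟨hag, hmono⟩ := hS hz
      rw [hρ₂]
      refine (iff_of_eq (congrArg _ ?_)).1
        (hψ ((List.range (t α)).map fun m => r (σ ⟨0, by omega⟩ (e m))) (fun j => r (σ j α)) ?_)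
      · funext s z
        refine congrArg (fun l => c l s z.2) ?_
        change _ = (List.range (t α + 1)).map fun m => r (tr α (σ z.1) (e m))
        rw [List.range_succ, List.map_append, List.map_singleton, htr α _ h h' _ le_rfl, h]
        congr 1
        refine List.map_congr_left fun m hm => ?_
        have hm := List.mem_range.1 hm
        rw [htr α _ h h' m hm.le]
        exact congrArg r (hag _ z.1 _ (h' m hm))
      · intro i j hij
        exact hr (Set.mem_biUnion hz ⟨i, rfl⟩) (Set.mem_biUnion hz ⟨j, rfl⟩) (hmono hij))
  obtain ⟨y, x, rfl⟩ : ∃ (y : ∀ s, (N × (N → Λ)) × Var Δ s → M.Carrier s)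
      (x : ∀ s, (N → Λ) × Var Γ s → M.Carrier s), a = join y x :=
    ⟨fun s z => a s (.inl z), fun s z => a s (.inr z), by
      funext s z
      rcases z with z | z <;> rfl⟩
  refine ⟨fun α σ s i => y s ((α, tr α σ), i), fun α σ σ' h => ?_, fun σ => ?_, fun α σ h h' => ?_⟩
  · have htr : tr α σ = tr α σ' := by
      funext β
      by_cases hβ : β ≤ α
      · simp only [tr, if_pos hβ, h β hβ]
      · simp only [tr, if_neg hβ]
    simp only [htr]
  · exact ⟨fun s i => x s (σ, i), fun α => (hρ₁ α σ y x).1 (ha _ ⟨.inl (α, σ), trivial, rfl⟩)⟩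
  · exact (hρ₂ α σ y x).1 (ha _ ⟨.inr (α, σ), ⟨h, h'⟩, rfl⟩)

theorem exists_strictMono_of_infinite {Λ : Type u} [LinearOrder Λ] [WellFoundedLT Λ] {S : Set Λ}
    (hS : S.Infinite) : ∃ g : ℕ → Λ, StrictMono g ∧ ∀ n, g n ∈ S := by
  have := hS.to_subtype
  obtain ⟨g, hg⟩ := exists_increasing_or_nonincreasing_subseq (· < ·) (Infinite.natEmbedding S)
  rcases hg with hg | hg
  · exact ⟨fun n => (Infinite.natEmbedding S (g n)).1, fun m n h => hg m n h,
      fun n => Subtype.prop _⟩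
  · obtain ⟨n, hn⟩ := WellFounded.not_rel_apply_succ (r := (· < · : S → S → Prop))
      fun n => Infinite.natEmbedding S (g n)
    refine absurd (lt_of_le_of_ne (not_lt.1 (hg n (n + 1) n.lt_succ_self)) fun h => ?_) hn
    exact n.succ_ne_self (g.injective ((Infinite.natEmbedding S).injective h))

/-- A formula with the tree property divides along arbitrarily long sequences of parameters. In a
sufficiently wide tree, a path is chosen such that every node has infinitely many siblings of
the same type over the earlier nodes of the path. -/
theorem IsMonster.exists_dividing_path (hM : IsMonster T M) {k : ℕ} (hk : 2 ≤ k)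
    {Γ Δ : List L.Srt} {φ : Formula L (fun s => Var Γ s ⊕ Var Δ s)}
    (h : HasTreeProperty T M k φ) (N : Type u) [LinearOrder N] [WellFoundedLT N] [Nonempty N] :
    ∃ (ψ : Formula L (fun s => Fin k × Var Δ s)) (x : ∀ s, Var Γ s → M.Carrier s)
      (d : N → ∀ s, Var Δ s → M.Carrier s), Obstructs T k φ ψ ∧ ∀ α, φ.Realize M (join x (d α)) ∧
        SpreadBy M (fun s => {m | ∃ β < α, ∃ i, d β s i = m}) ψ (d α) := by
  obtain ⟨ψ, c₀, hobs, hφ, hψ⟩ := h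
  let K := Σ α : N, Set (Formula L (fun s => Var Δ s ⊕ (Set.Iio α × Var Δ s)))
  let κ : Cardinal.{u} := Order.succ (max (Cardinal.mk K) Cardinal.aleph0)
  let Λ := κ.ord.ToType
  have hΛ : Cardinal.mk Λ = κ := Cardinal.mk_ord_toType _
  have hKΛ : Cardinal.mk K < Cardinal.mk Λ := by
    rw [hΛ]
    exact Order.lt_succ_of_le (le_max_left _ _)
  have hinf : Infinite Λ := by
    rw [Cardinal.infinite_iff, hΛ]
    exact (le_max_right _ _).trans (Order.le_succ _)
  obtain ⟨c, hc, hcφ, hcψ⟩ := hM.exists_wide_tree hk hφ hψ N Λ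
  have hpig : ∀ (α : N) (τ : N → Λ), ∃ (j : Λ) (g : ℕ → Λ), StrictMono g ∧ ∀ n,
      TypeEq M
        (join (c α (Function.update τ α j)) fun s (z : Set.Iio α × Var Δ s) => c z.1 τ s z.2)
        (join (c α (Function.update τ α (g n)))
          fun s (z : Set.Iio α × Var Δ s) => c z.1 τ s z.2) := by
    intro α τ
    let p : ∀ s, Set.Iio α × Var Δ s → M.Carrier s := fun s z => c z.1 τ s z.2
    let f : Λ → K := fun j =>
      ⟨α, {θ | θ.Realize M (join (c α (Function.update τ α j)) p)}⟩
    obtain ⟨q, hq⟩ := Cardinal.exists_infinite_fiber f hKΛ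
    obtain ⟨g, hg, hgq⟩ := exists_strictMono_of_infinite (Set.infinite_coe_iff.1 hq)
    refine ⟨g 0, g, hg, fun n θ => ?_⟩
    have : f (g 0) = f (g n) := (hgq 0).trans (hgq n).symm
    exact iff_of_eq (congrFun (eq_of_heq (Sigma.mk.inj_iff.1 this).2) θ)
  choose J g hg hJ using hpig
  -- `σ` is defined by recursion; `cut α σ` is the part of `σ` that is known before stage `α`
  let cut : N → (N → Λ) → N → Λ := fun α σ β =>
    open Classical in if β < α then σ β else Classical.arbitrary Λ
  obtain ⟨σ, hσ⟩ : ∃ σ : N → Λ, ∀ α, σ α = J α (cut α σ) := by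
    classical
    refine ⟨wellFounded_lt.fix fun α rec =>
      J α fun β => if h : β < α then rec β h else Classical.arbitrary Λ, fun α => ?_⟩
    rw [WellFounded.fix_eq]
    congr 1
  have hcut : ∀ α, ∀ β < α, cut α σ β = σ β := fun α β h => if_pos h
  obtain ⟨x, hx⟩ := hcφ σ
  refine ⟨ψ, x, fun α => c α σ, hobs, fun α => ⟨hx α,
    fun n => c α (Function.update (cut α σ) α (g α (cut α σ) n)), fun n => ?_, fun i hi => ?_⟩⟩
  · have h₁ : c α (Function.update (cut α σ) α (J α (cut α σ))) = c α σ := by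
      refine hc α _ _ fun β hβ => ?_
      rcases hβ.lt_or_eq with hβ | rfl
      · rw [Function.update_of_ne hβ.ne, hcut α β hβ]
      · rw [Function.update_self, hσ]
    change SameType M _ (c α σ) _
    rw [← h₁]
    refine sameType_of_typeEq ?_ (hJ α (cut α σ) n)
    rintro s m ⟨β, hβ, i, rfl⟩
    refine ⟨(⟨β, hβ⟩, i), ?_⟩
    rw [hc β (cut α σ) σ fun γ hγ => hcut α γ (hγ.trans_lt hβ)]
  · refine hcψ α (fun j => Function.update (cut α σ) α (g α (cut α σ) (i j))) ?_ ?_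
    · intro j j' β hβ
      rw [Function.update_of_ne hβ.ne, Function.update_of_ne hβ.ne]
    · intro j j' hjj'
      simp only [Function.update_self]
      exact hg _ _ (hi hjj')

/-- If some formula has the tree property, then local character fails for a finite set, whatever
the bound. -/
theorem IsMonster.exists_not_divIndep (hM : IsMonster T M) (h : ¬ NTP T M) (lam : Cardinal.{u}) :
    ∃ A C : Elems M, A.card < Cardinal.aleph0 ∧ C.IsSmall ∧
      ∀ C' ≤ C, C'.card < Cardinal.lift.{u + 1} lam → ¬ DivIndep M A C' C := by
  obtain ⟨k, Γ, Δ, φ, hk, h⟩ := not_not.1 h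
  let κ : Cardinal.{u} := Order.succ (max lam Cardinal.aleph0)
  have hreg : κ.IsRegular := Cardinal.isRegular_succ (le_max_right _ _)
  let N := κ.ord.ToType
  have : Nonempty N := ⟨Ordinal.ToType.mk ⟨0, hreg.ord_pos⟩⟩
  obtain ⟨ψ, x, d, hobs, hd⟩ := hM.exists_dividing_path hk h N
  have hCs : Elems.IsSmall (M := M) (fun s => {m | ∃ α, ∃ i, d α s i = m}) :=
    Elems.isSmall_of_forall_exists (I := fun s => N × Var Δ s) (fun s z => d z.1 s z.2) (by
      rintro s m ⟨α, i, rfl⟩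
      exact ⟨(α, i), rfl⟩)
  refine ⟨fun s => Set.range (x s), fun s => {m | ∃ α, ∃ i, d α s i = m}, ?_, hCs, ?_⟩
  · have : Finite (Σ s, Set.range (x s)) := by
      refine Finite.of_surjective (α := Σ s, Var Γ s) (fun z => ⟨z.1, x z.1 z.2, z.2, rfl⟩) ?_
      rintro ⟨s, _, i, rfl⟩
      exact ⟨⟨s, i⟩, rfl⟩
    exact Cardinal.lt_aleph0_of_finite _
  · intro C' hC' hcard
    choose pos hpos using hC'
    have hbdd : ∃ α : N, ∀ s m hm, pos s (a := m) hm < α := by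
      let R : Set N := Set.range fun z : Σ s, C' s => pos z.1 z.2.2
      have hR : Cardinal.mk R < κ := by
        have h₁ : Cardinal.lift.{u + 1} (Cardinal.mk R) ≤ C'.card := by
          have := Cardinal.mk_range_le_lift (f := fun z : Σ s, C' s => pos z.1 z.2.2)
          rwa [Cardinal.lift_id'.{u, u + 1}] at this
        exact (Cardinal.lift_lt.1 (h₁.trans_lt hcard)).trans_le
          ((le_max_left _ _).trans (Order.le_succ _))
      have hR' : ¬ IsCofinal R := fun hR' => by
        have := Order.cof_le hR'
        rw [Ordinal.cof_toType, hreg.cof_ord] at this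
        exact this.not_gt hR
      obtain ⟨α, hα⟩ := not_forall.1 hR'
      exact ⟨α, fun s m hm => not_le.1 fun hle => hα ⟨_, ⟨⟨s, m, hm⟩, rfl⟩, hle⟩⟩
    obtain ⟨α, hα⟩ := hbdd
    have hC's : C'.IsSmall := Elems.isSmall_of_card_le hcard.le
    obtain ⟨hφ, hsp⟩ := hd α
    have hsp' : SpreadBy M C' ψ (d α) := by
      refine hsp.mono ?_
      intro s m hm
      exact ⟨pos s hm, hα s m hm, hpos s hm⟩
    exact DivWitness.not_divIndep hM hCs hC's ⟨k, Γ, Δ, φ, ψ, fun s i => ⟨x s i, i, rfl⟩, d α, hk,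
      hobs, fun s i => .inl ⟨α, i, rfl⟩, hφ, hsp'⟩

end LongPath

/-! ### The equivalences -/

section Equivalences

variable {T : Theory L} {M : Structure.{u, u + 1} L}

theorem divIndep_of_isEmpty [IsEmpty L.Srt] (A C B : Elems M) : DivIndep M A C B := by
  rintro ⟨b, -, -, h⟩
  refine h ⟨fun s => isEmptyElim s, fun i φ hφ => (iff_of_eq (congrArg _ ?_)).1 hφ⟩
  funext s
  exact isEmptyElim s

theorem Elems.card_of_isEmpty [IsEmpty L.Srt] (A : Elems M) : A.card = 0 :=
  Cardinal.mk_eq_zero _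

theorem IsMonster.ntp_of_bound (hM : IsMonster T M) (lam : Cardinal.{u})
    (h : ∀ A : Elems M, A.card < Cardinal.aleph0 → ∀ C : Elems M, C.IsSmall →
      ∃ C' ≤ C, C'.card < Cardinal.lift.{u + 1} lam ∧ DivIndep M A C' C) : NTP T M := by
  by_contra hN
  obtain ⟨A, C, hA, hC, hdep⟩ := hM.exists_not_divIndep hN lam
  obtain ⟨C', hC', hcard, hind⟩ := h A hA C hC
  exact hdep C' hC' hcard hind

end Equivalences

end PositiveLogic

theorem mainTheorem7 (L : PositiveLogic.Signature.{u}) (T : PositiveLogic.Theory L)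
    (hT : PositiveLogic.JCP T) (M : PositiveLogic.Structure.{u, u + 1} L)
    (hM : PositiveLogic.IsMonster T M) :
    List.TFAE [
      -- (i) dividing independence has local character
      PositiveLogic.LocalCharacter (PositiveLogic.DivIndep M),
      -- (ii) local character for finite tuples, with bound `|T|⁺`
      ∀ A : PositiveLogic.Elems M, A.card < Cardinal.aleph0 →
        ∀ C : PositiveLogic.Elems M, C.IsSmall →
          ∃ C' : PositiveLogic.Elems M, C' ≤ C ∧
            C'.card < Cardinal.lift.{u + 1} (Order.succ T.card) ∧
            PositiveLogic.DivIndep M A C' C,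
      -- (iii) the sequence version of (i)
      ∀ κ : Cardinal.{u}, ∃ lam : Cardinal.{u},
        ∀ A : PositiveLogic.Elems M, A.card < Cardinal.lift.{u + 1} κ →
          ∀ (μ : Ordinal.{u}) (b : Set.Iio μ → PositiveLogic.Elems M),
            μ ≤ lam.ord → (∀ i, (b i).IsSmall) →
              ∃ i₀ < lam.ord, PositiveLogic.DivIndep M A
                (PositiveLogic.below μ b i₀) (PositiveLogic.above μ b i₀),
      -- (iv) the sequence version of (ii)
      ∀ A : PositiveLogic.Elems M, A.card < Cardinal.aleph0 →
        ∀ (μ : Ordinal.{u}) (b : Set.Iio μ → PositiveLogic.Elems M),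
          μ ≤ (Order.succ T.card).ord → (∀ i, (b i).IsSmall) →
            ∃ i₀ < (Order.succ T.card).ord, PositiveLogic.DivIndep M A
              (PositiveLogic.below μ b i₀) (PositiveLogic.above μ b i₀),
      -- (v) the theory is NTP
      PositiveLogic.NTP T M] := by
  tfae_have 1 → 5 := by
    intro h
    obtain ⟨lam, hlam⟩ := h Cardinal.aleph0
    refine hM.ntp_of_bound lam fun A hA C hC => ?_
    exact hlam A (by simpa using hA) C hC
  tfae_have 2 → 5 := fun h => hM.ntp_of_bound _ h
  tfae_have 5 → 3 := by
    intro hN κ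
    refine ⟨Order.succ (max (max κ T.card) Cardinal.aleph0), fun A hA μ b hμ hb => ?_⟩
    refine hM.exists_divIndep_above hN (le_max_right _ _)
      ((le_max_right _ _).trans (le_max_left _ _)) (hA.le.trans ?_) μ b hμ hb
    rw [Cardinal.lift_le]
    exact (le_max_left _ _).trans (le_max_left _ _)
  -- `|T|` is infinite as soon as there is a sort; without sorts all tuples are empty.
  tfae_have 5 → 4 := by
    intro hN A hA μ b hμ hb
    rcases isEmpty_or_nonempty L.Srt with hS | hS
    · refine ⟨0, ?_, PositiveLogic.divIndep_of_isEmpty _ _ _⟩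
      rw [Cardinal.lt_ord, Ordinal.card_zero]
      exact Order.bot_lt_succ _
    · exact hM.exists_divIndep_above hN PositiveLogic.aleph0_le_card le_rfl
        (hA.le.trans (by simpa using PositiveLogic.aleph0_le_card)) μ b hμ hb
  tfae_have 3 → 1 := by
    intro h κ
    obtain ⟨lam, hlam⟩ := h κ
    refine ⟨max lam (Order.succ Cardinal.aleph0), fun A hA C hC => ?_⟩
    exact hM.exists_divIndep_subset (PositiveLogic.Elems.isSmall_of_card_le hA.le) hC
      (le_max_left _ _) ((Order.lt_succ _).trans_le (le_max_right _ _))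
      fun b hb => hlam A hA _ b le_rfl hb
  tfae_have 4 → 2 := by
    intro h A hA C hC
    rcases isEmpty_or_nonempty L.Srt with hS | hS
    · refine ⟨C, le_rfl, ?_, PositiveLogic.divIndep_of_isEmpty _ _ _⟩
      rw [PositiveLogic.Elems.card_of_isEmpty, ← Cardinal.lift_zero.{u, u + 1}, Cardinal.lift_lt]
      exact Order.bot_lt_succ _
    · have hA' : A.IsSmall := PositiveLogic.Elems.isSmall_of_card_le
        (ν := Cardinal.aleph0) (by simpa using hA.le)
      exact hM.exists_divIndep_subset hA' hC le_rfl
        (Order.lt_succ_of_le PositiveLogic.aleph0_le_card) fun b hb => h A hA _ b le_rfl hb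
  tfae_finish
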